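/- Let $(\bar M,\varphi,g)$ be a Kähler manifold: $(\bar M,g)$ is a Riemannian manifold and $\varphi$ is a smooth $(1,1)$-tensor field on $\bar M$ with $\varphi^2=-I$, $g(\varphi\cdot,\varphi\cdot)=g$ and $\bar\nabla\varphi=0$, where $\bar\nabla$ is the Levi-Civita connection of $g$. Let $M$ be a submanifold of $\bar M$ defined by an injective immersion, with the induced metric, also denoted $g$, and its Levi-Civita connection $\nabla$. For $X$ tangent to $M$ let $TX$ be the tangential component of $\varphi X$. For a distribution $\mathcal D\subseteq TM$ let $\Gamma(\mathcal D)$ be the set of smooth vector fields on $M$ with values in $\mathcal D$; $\mathcal D$ is integrable if $[X,Y]\in\Gamma(\mathcal D)$ for all $X,Y\in\Gamma(\mathcal D)$. Let $k\ge 1$ and suppose that $M$ is a pointwise $k$-slant submanifold of $\bar M$: there are pairwise orthogonal smooth distributions $\mathcal D_0,\mathcal D_1,\dots,\mathcal D_k$ of constant rank on $M$ such that - $TM=\mathcal D_0\oplus\mathcal D_1\oplus\dots\oplus\mathcal D_k$; - $T(\mathcal D_i)\subseteq\mathcal D_i$ for $i\in\{1,\dots,k\}$; - $\varphi(\mathcal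 D_0)\subseteq\mathcal D_0$ (where $\mathcal D_0$ may be trivial), and each $\mathcal D_i$ with $i\in\{1,\dots,k\}$ is nontrivial and pointwise slant with slant function $\theta_i:M\to(0,\frac{\pi}{2}]$, that is, for every $p\in M$ and every nonzero $X_p\in(\mathcal D_i)_p$ the angle between $\varphi X_p$ and the subspace $(\mathcal D_i)_p$ is $\theta_i(p)$; moreover $\theta_i(p)\ne\theta_j(p)$ for all $p\in M$ and all $i\neq j$ in $\{1,\dots,k\}$. Put $\theta_0=0$. Suppose that $M$ is totally geodesic, that is, its second fundamental form $h(X,Y)=\bar\nabla_XY-\nabla_XY$ vanishes. Then: (i) $\mathcal D_0$ is an integrable distribution; (ii) for every $i\in\{0,\dots,k\}$ such that $\theta_j(p)\neq\frac{\pi}{2}$ for all $p\in M$ and all $j\in\{0,\dots,k\}$ with $j\neq i$, the distribution $\mathcal D_i$ is integrable if and only if $$\nabla_X TY-\nabla_Y TX\in\Gamma(\mathcal D_i)\quad\text{for all }X,Y\in\Gamma(\mathcal D_i).$$ -/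

import Mathlib

open Bundle VectorField
open scoped Manifold ContDiff InnerProductSpace

namespace SlantGeometry

set_option linter.unusedSectionVars false

noncomputable section

section LeviCivita

variable {E : Type*} [NormedAddCommGroup E] [NormedSpace ℝ E]
  {M : Type*} [TopologicalSpace M] [ChartedSpace E M] [IsManifold 𝓘(ℝ, E) ∞ M]

/-- `X` is a smooth vector field on `M`. -/
def IsSmoothField (X : Π x : M, TangentSpace 𝓘(ℝ, E) x) : Prop :=
  CMDiff ∞ (T% X)

end LeviCivita

section LeviCivita

variable {E : Type*} [NormedAddCommGroup E] [NormedSpace ℝ E] [FiniteDimensional ℝ E]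
  {M : Type*} [TopologicalSpace M] [ChartedSpace E M] [IsManifold 𝓘(ℝ, E) ∞ M]
  [RiemannianBundle (fun x : M ↦ TangentSpace 𝓘(ℝ, E) x)]

/-- The Koszul expression, which equals `2 g(∇_X Y, Z)` for the Levi-Civita connection `∇`. -/
def koszul (X Y Z : Π x : M, TangentSpace 𝓘(ℝ, E) x) (x : M) : ℝ :=
  mvfderiv 𝓘(ℝ, E) (fun q ↦ ⟪Y q, Z q⟫_ℝ) x (X x)
    + mvfderiv 𝓘(ℝ, E) (fun q ↦ ⟪Z q, X q⟫_ℝ) x (Y x)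
    - mvfderiv 𝓘(ℝ, E) (fun q ↦ ⟪X q, Y q⟫_ℝ) x (Z x)
    + ⟪mlieBracket 𝓘(ℝ, E) X Y x, Z x⟫_ℝ
    - ⟪mlieBracket 𝓘(ℝ, E) Y Z x, X x⟫_ℝ
    + ⟪mlieBracket 𝓘(ℝ, E) Z X x, Y x⟫_ℝ

/-- `D` is a Levi-Civita connection of `M`: metric and torsion-free. Here `D Y x u` is
`(∇_u Y)(x)`. -/
structure IsLeviCivita
    (D : CovariantDerivative 𝓘(ℝ, E) E (fun x : M ↦ TangentSpace 𝓘(ℝ, E) x)) : Prop where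
  metric : ∀ (Y Z : Π x : M, TangentSpace 𝓘(ℝ, E) x) (x : M), MDiffAt (T% Y) x →
    MDiffAt (T% Z) x → ∀ u : TangentSpace 𝓘(ℝ, E) x,
      mvfderiv 𝓘(ℝ, E) (fun q ↦ ⟪Y q, Z q⟫_ℝ) x u = ⟪D Y x u, Z x⟫_ℝ + ⟪Y x, D Z x u⟫_ℝ
  torsion_free : ∀ (X Y : Π x : M, TangentSpace 𝓘(ℝ, E) x) (x : M), MDiffAt (T% X) x →
    MDiffAt (T% Y) x → D Y x (X x) - D X x (Y x) = mlieBracket 𝓘(ℝ, E) X Y x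

theorem inner_comm_fun (Y Z : Π x : M, TangentSpace 𝓘(ℝ, E) x) :
    (fun q ↦ ⟪Y q, Z q⟫_ℝ) = fun q ↦ ⟪Z q, Y q⟫_ℝ := by
  funext q
  exact real_inner_comm _ _

variable [IsContMDiffRiemannianBundle 𝓘(ℝ, E) ∞ E (fun x : M ↦ TangentSpace 𝓘(ℝ, E) x)]

theorem mdiff_inner {Y Z : Π x : M, TangentSpace 𝓘(ℝ, E) x} {x : M}
    (hY : MDiffAt (T% Y) x) (hZ : MDiffAt (T% Z) x) :
    MDifferentiableAt 𝓘(ℝ, E) 𝓘(ℝ, ℝ) (fun q ↦ ⟪Y q, Z q⟫_ℝ) x :=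
  MDifferentiableAt.inner_bundle (IB := 𝓘(ℝ, E)) (F := E) (E := fun x : M ↦ TangentSpace 𝓘(ℝ, E) x)
    (v := Y) (w := Z) (b := fun x ↦ x) hY hZ

theorem mvfderiv_inner_smul {Y Z : Π x : M, TangentSpace 𝓘(ℝ, E) x} {f : M → ℝ} {x : M}
    (hf : MDiffAt f x) (hY : MDiffAt (T% Y) x) (hZ : MDiffAt (T% Z) x)
    (u : TangentSpace 𝓘(ℝ, E) x) :
    mvfderiv 𝓘(ℝ, E) (fun q ↦ ⟪(f • Y) q, Z q⟫_ℝ) x u =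
      f x * mvfderiv 𝓘(ℝ, E) (fun q ↦ ⟪Y q, Z q⟫_ℝ) x u
        + mvfderiv 𝓘(ℝ, E) f x u * ⟪Y x, Z x⟫_ℝ := by
  have h : (fun q ↦ ⟪(f • Y) q, Z q⟫_ℝ) = fun q ↦ f q * ⟪Y q, Z q⟫_ℝ := by
    funext q
    simp [inner_smul_left]
  rw [h, mvfderiv_fun_mul hf (mdiff_inner hY hZ)]
  simp
  ring

theorem mvfderiv_inner_add {Y Y' Z : Π x : M, TangentSpace 𝓘(ℝ, E) x} {x : M}
    (hY : MDiffAt (T% Y) x) (hY' : MDiffAt (T% Y') x) (hZ : MDiffAt (T% Z) x)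
    (u : TangentSpace 𝓘(ℝ, E) x) :
    mvfderiv 𝓘(ℝ, E) (fun q ↦ ⟪(Y + Y') q, Z q⟫_ℝ) x u =
      mvfderiv 𝓘(ℝ, E) (fun q ↦ ⟪Y q, Z q⟫_ℝ) x u
        + mvfderiv 𝓘(ℝ, E) (fun q ↦ ⟪Y' q, Z q⟫_ℝ) x u := by
  have h : (fun q ↦ ⟪(Y + Y') q, Z q⟫_ℝ) = fun q ↦ ⟪Y q, Z q⟫_ℝ + ⟪Y' q, Z q⟫_ℝ := by
    funext q
    simp [inner_add_left]
  rw [h, mvfderiv_fun_add (mdiff_inner hY hZ) (mdiff_inner hY' hZ)]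
  simp

theorem koszul_tensorial_left (Y Z : Π x : M, TangentSpace 𝓘(ℝ, E) x) {x : M}
    (hY : MDiffAt (T% Y) x) (hZ : MDiffAt (T% Z) x) :
    TensorialAt 𝓘(ℝ, E) E (fun X ↦ koszul X Y Z x) x where
  smul {f X} hf hX := by
    simp only [koszul]
    rw [inner_comm_fun Z (f • X), inner_comm_fun Z X, mvfderiv_inner_smul hf hX hZ,
      mvfderiv_inner_smul hf hX hY, mlieBracket_smul_left hf hX, mlieBracket_smul_right hf hX]
    simp [inner_smul_left, inner_smul_right, inner_add_left, real_inner_comm]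
    ring
  add {X X'} hX hX' := by
    simp only [koszul]
    rw [inner_comm_fun Z (X + X'), inner_comm_fun Z X, inner_comm_fun Z X',
      mvfderiv_inner_add hX hX' hZ, mvfderiv_inner_add hX hX' hY, mlieBracket_add_left hX hX',
      mlieBracket_add_right hX hX']
    simp [inner_add_left, inner_add_right]
    ring

theorem koszul_tensorial_right (X Y : Π x : M, TangentSpace 𝓘(ℝ, E) x) {x : M}
    (hX : MDiffAt (T% X) x) (hY : MDiffAt (T% Y) x) :
    TensorialAt 𝓘(ℝ, E) E (fun Z ↦ koszul X Y Z x) x where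
  smul {f Z} hf hZ := by
    simp only [koszul]
    rw [inner_comm_fun Y (f • Z), inner_comm_fun Y Z, mvfderiv_inner_smul hf hZ hX,
      mvfderiv_inner_smul hf hZ hY, mlieBracket_smul_left hf hZ, mlieBracket_smul_right hf hZ]
    simp [inner_smul_left, inner_smul_right, inner_add_left, real_inner_comm]
    ring
  add {Z Z'} hZ hZ' := by
    simp only [koszul]
    rw [inner_comm_fun Y (Z + Z'), inner_comm_fun Y Z, inner_comm_fun Y Z',
      mvfderiv_inner_add hZ hZ' hX, mvfderiv_inner_add hZ hZ' hY, mlieBracket_add_left hZ hZ',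
      mlieBracket_add_right hZ hZ']
    simp [inner_add_left, inner_add_right]
    ring

theorem koszul_add_mid {X Y Y' Z : Π x : M, TangentSpace 𝓘(ℝ, E) x} {x : M}
    (hX : MDiffAt (T% X) x) (hY : MDiffAt (T% Y) x) (hY' : MDiffAt (T% Y') x)
    (hZ : MDiffAt (T% Z) x) :
    koszul X (Y + Y') Z x = koszul X Y Z x + koszul X Y' Z x := by
  simp only [koszul]
  rw [inner_comm_fun X (Y + Y'), inner_comm_fun X Y, inner_comm_fun X Y',
    mvfderiv_inner_add hY hY' hX, mvfderiv_inner_add hY hY' hZ, mlieBracket_add_left hY hY',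
    mlieBracket_add_right hY hY']
  simp [inner_add_left, inner_add_right]
  ring

theorem koszul_smul_mid {X Y Z : Π x : M, TangentSpace 𝓘(ℝ, E) x} {x : M} {f : M → ℝ}
    (hf : MDiffAt f x)
    (hX : MDiffAt (T% X) x) (hY : MDiffAt (T% Y) x) (hZ : MDiffAt (T% Z) x) :
    koszul X (f • Y) Z x
      = f x * koszul X Y Z x + 2 * (mvfderiv 𝓘(ℝ, E) f x (X x) * ⟪Y x, Z x⟫_ℝ) := by
  simp only [koszul]
  rw [inner_comm_fun X (f • Y), inner_comm_fun X Y, mvfderiv_inner_smul hf hY hX,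
    mvfderiv_inner_smul hf hY hZ, mlieBracket_smul_left hf hY, mlieBracket_smul_right hf hY]
  simp [inner_smul_left, inner_smul_right, inner_add_left, real_inner_comm]
  ring

instance instFiniteDimensionalTangent (x : M) : FiniteDimensional ℝ (TangentSpace 𝓘(ℝ, E) x) :=
  inferInstanceAs (FiniteDimensional ℝ E)

/-- Existence of the Levi-Civita connection. -/
theorem exists_isLeviCivita :
    ∃ D : CovariantDerivative 𝓘(ℝ, E) E (fun x : M ↦ TangentSpace 𝓘(ℝ, E) x),
      IsLeviCivita D := by
  classical
  have key : ∀ (Y : Π x : M, TangentSpace 𝓘(ℝ, E) x) (x : M),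
      ∃ A : TangentSpace 𝓘(ℝ, E) x →L[ℝ] TangentSpace 𝓘(ℝ, E) x,
        MDiffAt (T% Y) x → ∀ X Z : Π x : M, TangentSpace 𝓘(ℝ, E) x,
          MDiffAt (T% X) x → MDiffAt (T% Z) x →
          2 * ⟪A (X x), Z x⟫_ℝ = koszul X Y Z x := by
    intro Y x
    by_cases hY : MDiffAt (T% Y) x
    · have : CompleteSpace (TangentSpace 𝓘(ℝ, E) x) := FiniteDimensional.complete ℝ _
      let B := TensorialAt.mkHom₂ (I := 𝓘(ℝ, E)) (F := E) (F' := E)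
        (fun X Z ↦ koszul X Y Z x) x
        (fun Z hZ ↦ koszul_tensorial_left Y Z hY hZ) (fun X hX ↦ koszul_tensorial_right X Y hX hY)
      refine ⟨(1 / 2 : ℝ) • InnerProductSpace.continuousLinearMapOfBilin (𝕜 := ℝ) B, fun _ X Z hX hZ ↦ ?_⟩
      have h := TensorialAt.mkHom₂_apply (I := 𝓘(ℝ, E)) (F := E) (F' := E)
        (Φ := fun X Z ↦ koszul X Y Z x)
        (fun Z hZ ↦ koszul_tensorial_left Y Z hY hZ) (fun X hX ↦ koszul_tensorial_right X Y hX hY)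
        hX hZ
      rw [← h, _root_.smul_apply, inner_smul_left,
        InnerProductSpace.continuousLinearMapOfBilin_apply]
      simp [B]
    · exact ⟨0, fun h ↦ absurd h hY⟩
  choose D hD using key
  have ext' : ∀ {x : M} {A B : TangentSpace 𝓘(ℝ, E) x →L[ℝ] TangentSpace 𝓘(ℝ, E) x},
      (∀ X Z : Π x : M, TangentSpace 𝓘(ℝ, E) x, MDiffAt (T% X) x → MDiffAt (T% Z) x →
        2 * ⟪A (X x), Z x⟫_ℝ = 2 * ⟪B (X x), Z x⟫_ℝ) → A = B := by
    intro x A B h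
    ext1 u
    refine ext_inner_right ℝ fun w ↦ ?_
    have := h (FiberBundle.extend E u) (FiberBundle.extend E w)
      (FiberBundle.mdifferentiableAt_extend 𝓘(ℝ, E) E _) (FiberBundle.mdifferentiableAt_extend 𝓘(ℝ, E) E _)
    simpa using this
  let D' : CovariantDerivative 𝓘(ℝ, E) E (fun x : M ↦ TangentSpace 𝓘(ℝ, E) x) :=
    { toFun := D
      isCovariantDerivativeOnUniv :=
        { add := fun {Y Y' x} hY hY' _ ↦ ext' fun X Z hX hZ ↦ by
            have hs : MDiffAt (T% (Y + Y')) x := mdifferentiableAt_add_section hY hY'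
            rw [hD _ _ hs X Z hX hZ, koszul_add_mid hX hY hY' hZ,
              ← hD _ _ hY X Z hX hZ, ← hD _ _ hY' X Z hX hZ, _root_.add_apply,
              inner_add_left]
            ring
          leibniz := fun {Y f x} hY hf _ ↦ ext' fun X Z hX hZ ↦ by
            have hs : MDiffAt (T% (f • Y)) x := hf.smul_section hY
            rw [hD _ _ hs X Z hX hZ, koszul_smul_mid hf hX hY hZ,
              ← hD _ _ hY X Z hX hZ]
            simp [inner_add_left, inner_smul_left]
            ring } }
  have hD' : ∀ {x : M} {X Y Z : Π x : M, TangentSpace 𝓘(ℝ, E) x}, MDiffAt (T% X) x →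
      MDiffAt (T% Y) x → MDiffAt (T% Z) x → 2 * ⟪D' Y x (X x), Z x⟫_ℝ = koszul X Y Z x :=
    fun hX hY hZ ↦ hD _ _ hY _ _ hX hZ
  refine ⟨D', ?_, ?_⟩
  · intro Y Z x hY hZ u
    have hX := FiberBundle.mdifferentiableAt_extend 𝓘(ℝ, E) E u
    have hXx : FiberBundle.extend E u x = u := by simp
    generalize FiberBundle.extend E u = X at hX hXx
    subst hXx
    have h1 := hD' hX hY hZ
    have h2 := hD' hX hZ hY
    rw [real_inner_comm] at h2
    simp only [koszul] at h1 h2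
    rw [inner_comm_fun Z Y, inner_comm_fun Y X, inner_comm_fun X Z,
      mlieBracket_swap_apply (V := X) (W := Z), mlieBracket_swap_apply (V := Z) (W := Y),
      mlieBracket_swap_apply (V := Y) (W := X)] at h2
    simp only [inner_neg_left] at h2
    linarith
  · intro X Y x hX hY
    refine ext_inner_right ℝ fun w ↦ ?_
    have hW := FiberBundle.mdifferentiableAt_extend 𝓘(ℝ, E) E w
    have hWx : FiberBundle.extend E w x = w := by simp
    generalize FiberBundle.extend E w = W at hW hWx
    subst hWx
    have h1 := hD' hX hY hW
    have h2 := hD' hY hX hW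
    simp only [koszul] at h1 h2
    rw [inner_comm_fun X W, inner_comm_fun W Y, inner_comm_fun Y X,
      mlieBracket_swap_apply (V := Y) (W := X), mlieBracket_swap_apply (V := X) (W := W),
      mlieBracket_swap_apply (V := W) (W := Y)] at h2
    simp only [inner_neg_left] at h2
    rw [inner_sub_left]
    linarith

/-- The Levi-Civita connection `∇` of the Riemannian manifold `M`. Torsion-freeness and metric
compatibility determine its values on differentiable vector fields. -/
def leviCivita : CovariantDerivative 𝓘(ℝ, E) E (fun x : M ↦ TangentSpace 𝓘(ℝ, E) x) :=
  Classical.choose exists_isLeviCivita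

theorem isLeviCivita_leviCivita : IsLeviCivita (leviCivita (E := E) (M := M)) :=
  Classical.choose_spec exists_isLeviCivita

/-- The vector field `∇_X Y`. -/
def nabla (X Y : Π x : M, TangentSpace 𝓘(ℝ, E) x) : Π x : M, TangentSpace 𝓘(ℝ, E) x :=
  fun x ↦ leviCivita Y x (X x)

end LeviCivita

section Distributions

variable {E : Type*} [NormedAddCommGroup E] [NormedSpace ℝ E]
  {M : Type*} [TopologicalSpace M] [ChartedSpace E M] [IsManifold 𝓘(ℝ, E) ∞ M]

/-- `X ∈ Γ(D)`: `X` is a smooth vector field with values in the distribution `D`. -/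
def IsSectionOf (D : Π x : M, Submodule ℝ (TangentSpace 𝓘(ℝ, E) x))
    (X : Π x : M, TangentSpace 𝓘(ℝ, E) x) : Prop :=
  IsSmoothField X ∧ ∀ x, X x ∈ D x

/-- `D` is a smooth regular distribution: it has constant rank `r`, and near every point it is
spanned by a frame of `r` smooth local vector fields. -/
def IsSmoothRegular (D : Π x : M, Submodule ℝ (TangentSpace 𝓘(ℝ, E) x)) : Prop :=
  ∃ r : ℕ, ∀ x : M, ∃ U : Set M, IsOpen U ∧ x ∈ U ∧
    ∃ X : Fin r → Π y : M, TangentSpace 𝓘(ℝ, E) y,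
      (∀ a, CMDiff[U] ∞ (T% (X a))) ∧ ∀ y ∈ U, LinearIndependent ℝ (fun a ↦ X a y) ∧
        Submodule.span ℝ (Set.range fun a ↦ X a y) = D y

/-- `D` is integrable: `[X, Y] ∈ Γ(D)` for all `X, Y ∈ Γ(D)`. -/
def IsIntegrable (D : Π x : M, Submodule ℝ (TangentSpace 𝓘(ℝ, E) x)) : Prop :=
  ∀ X Y : Π x : M, TangentSpace 𝓘(ℝ, E) x, IsSectionOf D X → IsSectionOf D Y →
    IsSectionOf D (mlieBracket 𝓘(ℝ, E) X Y)

end Distributions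

section Kahler

variable {E : Type*} [NormedAddCommGroup E] [NormedSpace ℝ E] [FiniteDimensional ℝ E]
  {M : Type*} [TopologicalSpace M] [ChartedSpace E M] [IsManifold 𝓘(ℝ, E) ∞ M]
  [RiemannianBundle (fun x : M ↦ TangentSpace 𝓘(ℝ, E) x)]

/-- `φ` is a smooth `(1,1)`-tensor field with `φ² = -I` and `g(φ ·, φ ·) = g`. -/
structure IsAlmostHermitian
    (φ : Π x : M, TangentSpace 𝓘(ℝ, E) x →L[ℝ] TangentSpace 𝓘(ℝ, E) x) : Prop where
  smooth : ContMDiff 𝓘(ℝ, E) (𝓘(ℝ, E).prod 𝓘(ℝ, E →L[ℝ] E)) ∞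
    (fun x ↦ TotalSpace.mk' (E →L[ℝ] E)
      (E := fun x : M ↦ TangentSpace 𝓘(ℝ, E) x →L[ℝ] TangentSpace 𝓘(ℝ, E) x) x (φ x))
  sq : ∀ (x : M) (u : TangentSpace 𝓘(ℝ, E) x), φ x (φ x u) = -u
  inner_map : ∀ (x : M) (u v : TangentSpace 𝓘(ℝ, E) x), ⟪φ x u, φ x v⟫_ℝ = ⟪u, v⟫_ℝ

/-- `φ` makes the Riemannian manifold `M` a Kähler manifold: `φ` is almost Hermitian and
`∇φ = 0`, that is, `∇_X (φ Y) = φ (∇_X Y)`. -/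
structure IsKahler [IsContMDiffRiemannianBundle 𝓘(ℝ, E) ∞ E (fun x : M ↦ TangentSpace 𝓘(ℝ, E) x)]
    (φ : Π x : M, TangentSpace 𝓘(ℝ, E) x →L[ℝ] TangentSpace 𝓘(ℝ, E) x) : Prop
    extends IsAlmostHermitian φ where
  parallel : ∀ X Y : Π x : M, TangentSpace 𝓘(ℝ, E) x, IsSmoothField X → IsSmoothField Y →
    ∀ x, nabla X (fun y ↦ φ y (Y y)) x = φ x (nabla X Y x)

end Kahler

section Along

variable {E : Type*} [NormedAddCommGroup E] [NormedSpace ℝ E]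
  {M : Type*} [TopologicalSpace M] [ChartedSpace E M]
  {E' : Type*} [NormedAddCommGroup E'] [NormedSpace ℝ E'] [FiniteDimensional ℝ E']
  {N : Type*} [TopologicalSpace N] [ChartedSpace E' N] [IsManifold 𝓘(ℝ, E') ∞ N]
  [RiemannianBundle (fun x : N ↦ TangentSpace 𝓘(ℝ, E') x)]
  [IsContMDiffRiemannianBundle 𝓘(ℝ, E') ∞ E' (fun x : N ↦ TangentSpace 𝓘(ℝ, E') x)]

/-- The covariant derivative `∇_u V` of a vector field `V` along the map `f : M → N` in the
direction of `u ∈ T_p M`, for the Levi-Civita connection of `N`: in the local frame `e_a` of `TN`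
given by the chart at `f p`, if `V = ∑ V^a (e_a ∘ f)`, then
`∇_u V = ∑ (u V^a) e_a + V^a(p) ∇_{df u} e_a`. For a vector field on `N` restricted to `f` this is
the usual covariant derivative, see `nablaAlong_comp`. -/
def nablaAlong (f : M → N) (V : Π q : M, TangentSpace 𝓘(ℝ, E') (f q)) (p : M)
    (u : TangentSpace 𝓘(ℝ, E) p) : TangentSpace 𝓘(ℝ, E') (f p) :=
  (trivializationAt E' (fun y : N ↦ TangentSpace 𝓘(ℝ, E') y) (f p)).symm (f p)
      (mvfderiv 𝓘(ℝ, E) (fun q ↦ (trivializationAt E' (fun y : N ↦ TangentSpace 𝓘(ℝ, E') y) (f p)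
        ⟨f q, V q⟩).2) p u)
    + leviCivita (FiberBundle.extend E' (V p)) (f p) (mfderiv 𝓘(ℝ, E) 𝓘(ℝ, E') f p u)

/-- The Levi-Civita connection in the local frame given by a chart. -/
theorem leviCivita_eq_local {Z : Π y : N, TangentSpace 𝓘(ℝ, E') y} {x : N}
    (hZ : MDiffAt (T% Z) x) (u : TangentSpace 𝓘(ℝ, E') x) :
    leviCivita Z x u = (trivializationAt E' (fun y : N ↦ TangentSpace 𝓘(ℝ, E') y) x).symm x
      (mvfderiv 𝓘(ℝ, E') (fun q ↦ (trivializationAt E' (fun y : N ↦ TangentSpace 𝓘(ℝ, E') y) x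
        ⟨q, Z q⟩).2) x u)
      + leviCivita (FiberBundle.extend E' (Z x)) x u := by
  set e := trivializationAt E' (fun y : N ↦ TangentSpace 𝓘(ℝ, E') y) x with he
  have hx : x ∈ e.baseSet := FiberBundle.mem_baseSet_trivializationAt' x
  have hU : ∀ᶠ q in nhds x, q ∈ e.baseSet := e.open_baseSet.mem_nhds hx
  have hdiff : ∀ {σ : Π y : N, TangentSpace 𝓘(ℝ, E') y}, MDiffAt (T% σ) x →
      MDiffAt (fun q ↦ (e ⟨q, σ q⟩).2) x := by
    intro σ hσ
    exact (mdifferentiableAt_section 𝓘(ℝ, E') σ).1 hσ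
  have hlin : ∀ v w : E', ∀ c : ℝ, e.symm x (c • v + w) = c • e.symm x v + e.symm x w := by
    intro v w c
    rw [← e.coe_symmₗ (R := ℝ) hx, map_add, map_smul]
  have hinv : ∀ v : TangentSpace 𝓘(ℝ, E') x, e.symm x (e ⟨x, v⟩).2 = v := by
    intro v
    exact e.symm_apply_apply_mk hx v
  have hcong : ∀ {F G : N → E'}, (∀ᶠ q in nhds x, F q = G q) →
      mvfderiv 𝓘(ℝ, E') F x = mvfderiv 𝓘(ℝ, E') G x := by
    intro F G h
    have h0 : F x = G x := h.self_of_nhds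
    ext v
    have := Filter.EventuallyEq.mfderiv_eq (I := 𝓘(ℝ, E')) (I' := 𝓘(ℝ, E')) h
    simp only [mvfderiv]
    rw [this, h0]
  have hT : TensorialAt 𝓘(ℝ, E') E' (fun σ : Π y : N, TangentSpace 𝓘(ℝ, E') y ↦
      leviCivita σ x u - e.symm x (mvfderiv 𝓘(ℝ, E') (fun q ↦ (e ⟨q, σ q⟩).2) x u)) x := by
    constructor
    · intro f σ hf hσ
      have h1 : mvfderiv 𝓘(ℝ, E') (fun q ↦ (e ⟨q, (f • σ) q⟩).2) x
          = mvfderiv 𝓘(ℝ, E') (f • fun q ↦ (e ⟨q, σ q⟩).2) x := by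
        apply hcong
        filter_upwards [hU] with q hq
        exact (e.linear ℝ hq).map_smul (f q) (σ q)
      have h2 := hlin ((e ⟨x, σ x⟩).2) (f x • (mvfderiv 𝓘(ℝ, E') (fun q ↦ (e ⟨q, σ q⟩).2) x u))
        (mvfderiv 𝓘(ℝ, E') f x u)
      have h3 := hlin (mvfderiv 𝓘(ℝ, E') (fun q ↦ (e ⟨q, σ q⟩).2) x u) 0 (f x)
      have h4 := hlin 0 0 1
      simp only [smul_zero, add_zero, one_smul] at h3 h4
      rw [left_eq_add] at h4
      rw [h4, add_zero] at h3
      rw [h3, hinv, add_comm] at h2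
      rw [leviCivita.isCovariantDerivativeOnUniv.leibniz hσ hf, h1, mvfderiv_smul hf (hdiff hσ)]
      simp only [_root_.add_apply, _root_.smul_apply, ContinuousLinearMap.smulRight_apply]
      rw [h2]
      module
    · intro σ σ' hσ hσ'
      have h1 : mvfderiv 𝓘(ℝ, E') (fun q ↦ (e ⟨q, (σ + σ') q⟩).2) x
          = mvfderiv 𝓘(ℝ, E') ((fun q ↦ (e ⟨q, σ q⟩).2) + fun q ↦ (e ⟨q, σ' q⟩).2) x := by
        apply hcong
        filter_upwards [hU] with q hq
        exact (e.linear ℝ hq).map_add (σ q) (σ' q)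
      have h2 := hlin (mvfderiv 𝓘(ℝ, E') (fun q ↦ (e ⟨q, σ q⟩).2) x u)
        (mvfderiv 𝓘(ℝ, E') (fun q ↦ (e ⟨q, σ' q⟩).2) x u) 1
      rw [one_smul, one_smul] at h2
      rw [leviCivita.isCovariantDerivativeOnUniv.add hσ hσ', h1,
        mvfderiv_add (hdiff hσ) (hdiff hσ')]
      simp only [_root_.add_apply]
      rw [h2]
      module
  have h := hT.pointwise hZ (FiberBundle.mdifferentiableAt_extend 𝓘(ℝ, E') E' (Z x)) (by simp)
  have hc : mvfderiv 𝓘(ℝ, E') (fun q ↦ (e ⟨q, FiberBundle.extend E' (Z x) q⟩).2) x = 0 := by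
    rw [← mvfderiv_const (I := 𝓘(ℝ, E')) ((e ⟨x, Z x⟩).2) (x := x)]
    apply hcong
    filter_upwards [hU] with q hq
    simp [FiberBundle.extend, ← he, hq]
  have h4 := hlin 0 0 1
  simp only [smul_zero, add_zero, one_smul] at h4
  rw [left_eq_add] at h4
  rw [hc] at h
  simp only [_root_.zero_apply, h4, sub_zero] at h
  rw [← h]
  abel

/-- For vector fields on `N` restricted to `f`, `nablaAlong` is the Levi-Civita connection. -/
theorem nablaAlong_comp {f : M → N} {p : M} (hf : MDifferentiableAt 𝓘(ℝ, E) 𝓘(ℝ, E') f p)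
    {Z : Π y : N, TangentSpace 𝓘(ℝ, E') y} (hZ : MDiffAt (T% Z) (f p))
    (u : TangentSpace 𝓘(ℝ, E) p) :
    nablaAlong f (fun q ↦ Z (f q)) p u
      = leviCivita Z (f p) (mfderiv 𝓘(ℝ, E) 𝓘(ℝ, E') f p u) := by
  rw [leviCivita_eq_local hZ, nablaAlong]
  congr 2
  have h := mfderiv_comp (I := 𝓘(ℝ, E)) (I' := 𝓘(ℝ, E')) (I'' := 𝓘(ℝ, E')) p
    ((mdifferentiableAt_section 𝓘(ℝ, E') Z).1 hZ) hf
  simp only [mvfderiv]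
  exact congr($h u)

end Along

section Submanifold

variable {E : Type*} [NormedAddCommGroup E] [NormedSpace ℝ E] [FiniteDimensional ℝ E]
  {M : Type*} [TopologicalSpace M] [ChartedSpace E M] [IsManifold 𝓘(ℝ, E) ∞ M]
  [RiemannianBundle (fun x : M ↦ TangentSpace 𝓘(ℝ, E) x)]
  {E' : Type*} [NormedAddCommGroup E'] [NormedSpace ℝ E'] [FiniteDimensional ℝ E']
  {N : Type*} [TopologicalSpace N] [ChartedSpace E' N] [IsManifold 𝓘(ℝ, E') ∞ N]
  [RiemannianBundle (fun x : N ↦ TangentSpace 𝓘(ℝ, E') x)]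

variable (E E') in
/-- `f` is a smooth injective immersion and the metric of `M` is the one induced by `f`. -/
structure IsRiemannianSubmanifold (f : M → N) : Prop where
  injective : Function.Injective f
  smooth : ContMDiff 𝓘(ℝ, E) 𝓘(ℝ, E') ∞ f
  immersion : ∀ p, Function.Injective (mfderiv 𝓘(ℝ, E) 𝓘(ℝ, E') f p)
  inner_map : ∀ (p : M) (u v : TangentSpace 𝓘(ℝ, E) p),
    ⟪mfderiv 𝓘(ℝ, E) 𝓘(ℝ, E') f p u, mfderiv 𝓘(ℝ, E) 𝓘(ℝ, E') f p v⟫_ℝ = ⟪u, v⟫_ℝ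

/-- The tangential component at `p` of a vector `w` of the ambient manifold at `f p`, as a vector
of `T_p M`: since `df_p` is isometric, the adjoint of `df_p` is the orthogonal projection onto
`df_p (T_p M)` followed by the inverse of `df_p`, see `mfderiv_tangentialPart`. -/
def tangentialPart (f : M → N) (p : M) :
    TangentSpace 𝓘(ℝ, E') (f p) →L[ℝ] TangentSpace 𝓘(ℝ, E) p :=
  have : CompleteSpace (TangentSpace 𝓘(ℝ, E) p) := FiniteDimensional.complete ℝ _
  have : CompleteSpace (TangentSpace 𝓘(ℝ, E') (f p)) := FiniteDimensional.complete ℝ _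
  ContinuousLinearMap.adjoint (mfderiv 𝓘(ℝ, E) 𝓘(ℝ, E') f p)

theorem inner_tangentialPart (f : M → N) (p : M) (w : TangentSpace 𝓘(ℝ, E') (f p))
    (u : TangentSpace 𝓘(ℝ, E) p) :
    ⟪tangentialPart f p w, u⟫_ℝ = ⟪w, mfderiv 𝓘(ℝ, E) 𝓘(ℝ, E') f p u⟫_ℝ := by
  have : CompleteSpace (TangentSpace 𝓘(ℝ, E) p) := FiniteDimensional.complete ℝ _
  have : CompleteSpace (TangentSpace 𝓘(ℝ, E') (f p)) := FiniteDimensional.complete ℝ _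
  exact ContinuousLinearMap.adjoint_inner_left _ _ _

theorem mfderiv_tangentialPart {f : M → N} (hf : IsRiemannianSubmanifold E E' f) (p : M)
    (w : TangentSpace 𝓘(ℝ, E') (f p)) :
    mfderiv 𝓘(ℝ, E) 𝓘(ℝ, E') f p (tangentialPart f p w) =
      (LinearMap.range (mfderiv 𝓘(ℝ, E) 𝓘(ℝ, E') f p).toLinearMap).starProjection w := by
  symm
  apply Submodule.eq_starProjection_of_mem_of_inner_eq_zero
  · exact ⟨_, rfl⟩
  · rintro _ ⟨u, rfl⟩
    have h := hf.inner_map p (tangentialPart f p w) u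
    rw [inner_tangentialPart] at h
    simp [inner_sub_left, h]

/-- The endomorphism `T` of `TM`: `T u` is the tangential component of `φ u`. -/
def tangentialEnd (φ : Π x : N, TangentSpace 𝓘(ℝ, E') x →L[ℝ] TangentSpace 𝓘(ℝ, E') x)
    (f : M → N) (p : M) : TangentSpace 𝓘(ℝ, E) p →L[ℝ] TangentSpace 𝓘(ℝ, E) p :=
  tangentialPart f p ∘L φ (f p) ∘L mfderiv 𝓘(ℝ, E) 𝓘(ℝ, E') f p

/-- The angle in `[0, π/2]` between a nonzero vector `w` and a subspace `S`: the angle between `w`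
and its orthogonal projection to `S`, which is `π/2` when the projection vanishes. -/
def angleWithSubspace {V : Type*} [NormedAddCommGroup V] [InnerProductSpace ℝ V] (w : V)
    (S : Submodule ℝ V) [S.HasOrthogonalProjection] : ℝ :=
  InnerProductGeometry.angle w (S.starProjection w)

/-- The image of a subspace of `T_p M` in the ambient tangent space. -/
def ambientImage (f : M → N) (p : M) (S : Submodule ℝ (TangentSpace 𝓘(ℝ, E) p)) :
    Submodule ℝ (TangentSpace 𝓘(ℝ, E') (f p)) :=
  S.map (mfderiv 𝓘(ℝ, E) 𝓘(ℝ, E') f p).toLinearMap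

/-- `D` is invariant: `φ(D) ⊆ D`. -/
def IsInvariantDistribution
    (φ : Π x : N, TangentSpace 𝓘(ℝ, E') x →L[ℝ] TangentSpace 𝓘(ℝ, E') x)
    (f : M → N) (D : Π x : M, Submodule ℝ (TangentSpace 𝓘(ℝ, E) x)) : Prop :=
  ∀ p, ∀ u ∈ D p, φ (f p) (mfderiv 𝓘(ℝ, E) 𝓘(ℝ, E') f p u) ∈ ambientImage f p (D p)

/-- `D` is a pointwise slant distribution with slant function `θ`: the angle between `φ u` and
`D_p` is nonzero and equal to `θ p` for all nonzero `u ∈ D_p`. -/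
def IsPointwiseSlant
    (φ : Π x : N, TangentSpace 𝓘(ℝ, E') x →L[ℝ] TangentSpace 𝓘(ℝ, E') x)
    (f : M → N) (D : Π x : M, Submodule ℝ (TangentSpace 𝓘(ℝ, E) x)) (θ : M → ℝ) : Prop :=
  ∀ p, θ p ≠ 0 ∧ ∀ u ∈ D p, u ≠ 0 →
    angleWithSubspace (φ (f p) (mfderiv 𝓘(ℝ, E) 𝓘(ℝ, E') f p u)) (ambientImage f p (D p)) = θ p

/-- The submanifold `f : M → N` is a pointwise `k`-slant submanifold, with component distributions
`D 0, …, D k` and slant functions `θ 1, …, θ k`; by convention `θ 0 = 0`. -/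
structure IsPointwiseKSlant
    (φ : Π x : N, TangentSpace 𝓘(ℝ, E') x →L[ℝ] TangentSpace 𝓘(ℝ, E') x)
    (f : M → N) (k : ℕ) (D : Fin (k + 1) → Π x : M, Submodule ℝ (TangentSpace 𝓘(ℝ, E) x))
    (θ : Fin (k + 1) → M → ℝ) : Prop where
  one_le : 1 ≤ k
  smooth_regular : ∀ i, IsSmoothRegular (D i)
  orthogonal : ∀ i j, i ≠ j → ∀ p, D i p ⟂ D j p
  direct_sum : ∀ p, DirectSum.IsInternal (fun i ↦ D i p)
  tangential_mem : ∀ i, i ≠ 0 → ∀ p, ∀ u ∈ D i p, tangentialEnd φ f p u ∈ D i p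
  invariant : IsInvariantDistribution φ f (D 0)
  nontrivial : ∀ i, i ≠ 0 → ∀ p, D i p ≠ ⊥
  slant : ∀ i, i ≠ 0 → IsPointwiseSlant φ f (D i) (θ i)
  angle_mem : ∀ i, i ≠ 0 → ∀ p, θ i p ∈ Set.Ioc 0 (Real.pi / 2)
  angle_ne : ∀ i j, i ≠ 0 → j ≠ 0 → i ≠ j → ∀ p, θ i p ≠ θ j p
  angle_zero : ∀ p, θ 0 p = 0

variable [IsContMDiffRiemannianBundle 𝓘(ℝ, E) ∞ E (fun x : M ↦ TangentSpace 𝓘(ℝ, E) x)]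
  [IsContMDiffRiemannianBundle 𝓘(ℝ, E') ∞ E' (fun x : N ↦ TangentSpace 𝓘(ℝ, E') x)]

variable (E') in
/-- The second fundamental form `h(X, Y)` at `p`, by the Gauss formula: the covariant derivative
of `Y` in the ambient manifold, minus `∇_X Y`. -/
def secondFundamentalForm (f : M → N) (X Y : Π x : M, TangentSpace 𝓘(ℝ, E) x) (p : M) :
    TangentSpace 𝓘(ℝ, E') (f p) :=
  nablaAlong f (fun q ↦ mfderiv 𝓘(ℝ, E) 𝓘(ℝ, E') f q (Y q)) p (X p)
    - mfderiv 𝓘(ℝ, E) 𝓘(ℝ, E') f p (nabla X Y p)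

variable (E E') in
/-- The submanifold is totally geodesic: `h = 0`. -/
def IsTotallyGeodesic (f : M → N) : Prop :=
  ∀ X Y : Π x : M, TangentSpace 𝓘(ℝ, E) x, IsSmoothField X → IsSmoothField Y →
    ∀ p, secondFundamentalForm E' f X Y p = 0

end Submanifold

end

end SlantGeometry

open SlantGeometry

/-! On a totally geodesic submanifold of a Kähler manifold the endomorphism `T` is parallel. For
tangent fields, `⟪TY, Z⟫ = ⟪φ df Y, df Z⟫`. Differentiating the right side along `X` in the ambient
manifold, `φ` passes through the derivative and, since `h = 0`, the derivatives of `df Y` and `df Z`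
are `df (∇_X Y)` and `df (∇_X Z)`. Comparing with `X⟪TY, Z⟫` on `M` gives `∇_X TY = T ∇_X Y`
(`IsTotallyGeodesic.nabla_tangentialEnd`), and vanishing torsion turns this into `T[X, Y] = ∇_X TY -
∇_Y TX`.

The rest is pointwise linear algebra: if `A` preserves every summand of a direct sum and is
injective on all but the `i`-th, then `A u ∈ D i` forces `u ∈ D i`
(`mem_of_apply_mem_of_isInternal`). For (ii) take `A = T`. It preserves all summands, which settles
one direction, and it is injective on `D j` when `θ j ≠ π/2`, because `T u` is the projection of `φ
u` to `D j`. For (i) take `A = T² + I`. It vanishes on `D 0` and commutes with `∇`, so it kills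
brackets of sections of `D 0`. On a slant `D j` it is injective: `T² u = -u` gives `|T u| = |u| = |φ
u|`, hence `φ u` is tangent and in `D j`, so the slant angle would be `0`.

The analytic work is to show that `TY` is smooth and that differentiation along `f` obeys the
Leibniz rules, is metric, and commutes with `φ`. -/

namespace SlantGeometry

set_option linter.unusedSectionVars false

/-! ### Extension of germs and tangent vectors to global smooth fields. -/

section GlobalFields

variable {E : Type*} [NormedAddCommGroup E] [NormedSpace ℝ E] [FiniteDimensional ℝ E]
  {M : Type*} [TopologicalSpace M] [T2Space M] [ChartedSpace E M] [IsManifold 𝓘(ℝ, E) ∞ M]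

/-- The germ at `x` of a vector field which is smooth near `x` extends to a global smooth field. -/
theorem exists_isSmoothField_eventuallyEq {σ : Π x : M, TangentSpace 𝓘(ℝ, E) x} {U : Set M} {x : M}
    (hU : IsOpen U) (hx : x ∈ U) (hσ : CMDiff[U] ∞ (T% σ)) :
    ∃ Z : Π x : M, TangentSpace 𝓘(ℝ, E) x, IsSmoothField Z ∧ ∀ᶠ q in nhds x, Z q = σ q := by
  obtain ⟨ψ, -, hψ⟩ :=
    (SmoothBumpFunction.nhds_basis_tsupport (I := 𝓘(ℝ, E)) x).mem_iff.1 (hU.mem_nhds hx)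
  -- The closed support of `ψ` lies in `U`, so smoothness of `σ` on `U` is enough; near `x` the bump
  -- function is `1`.
  refine ⟨(ψ : M → ℝ) • σ, ?_, ?_⟩
  · exact ContMDiffOn.smul_section_of_tsupport (ψ.contMDiff.contMDiffOn) hU hψ hσ
  · filter_upwards [ψ.eventuallyEq_one] with q hq
    simp [hq]

/-- Makes local frames available to statements that quantify over global fields only, such as
`IsKahler.parallel`. -/
theorem exists_isSmoothField_eventuallyEq_localFrame {ι : Type*} (b : Module.Basis ι ℝ E) (x : M)
    (i : ι) :
    ∃ Z : Π x : M, TangentSpace 𝓘(ℝ, E) x, IsSmoothField Z ∧ ∀ᶠ q in nhds x,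
      Z q = (trivializationAt E (fun y : M ↦ TangentSpace 𝓘(ℝ, E) y) x).localFrame b i q :=
  exists_isSmoothField_eventuallyEq
    (trivializationAt E (fun y : M ↦ TangentSpace 𝓘(ℝ, E) y) x).open_baseSet
    (FiberBundle.mem_baseSet_trivializationAt' x)
    (Trivialization.contMDiffOn_localFrame_baseSet ∞ _ b i)

/-- Every tangent vector extends to a global smooth vector field. -/
theorem exists_isSmoothField_apply_eq (x : M) (u : TangentSpace 𝓘(ℝ, E) x) :
    ∃ Z : Π x : M, TangentSpace 𝓘(ℝ, E) x, IsSmoothField Z ∧ Z x = u := by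
  obtain ⟨s, hs, h⟩ := FiberBundle.exists_contMDiffOn_extend 𝓘(ℝ, E) E (k := ∞) u
  obtain ⟨U, hUs, hU, hx⟩ := mem_nhds_iff.1 hs
  obtain ⟨Z, hZ, hZe⟩ := exists_isSmoothField_eventuallyEq hU hx (h.mono hUs)
  exact ⟨Z, hZ, by rw [hZe.self_of_nhds, FiberBundle.extend_apply_self]⟩

end GlobalFields

/-! ### Smooth dependence of solutions of linear systems. -/

section Cramer

variable {E : Type*} [NormedAddCommGroup E] [NormedSpace ℝ E]
  {M : Type*} [TopologicalSpace M] [ChartedSpace E M]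

theorem ContMDiffAt.matrix_det {ι : Type*} [Fintype ι] [DecidableEq ι] {A : M → Matrix ι ι ℝ}
    {p : M} (hA : ∀ i j, CMDiffAt ∞ (fun q ↦ A q i j) p) :
    CMDiffAt ∞ (fun q ↦ (A q).det) p := by
  simp only [Matrix.det_apply']
  exact ContMDiffAt.sum fun σ _ ↦ contMDiffAt_const.mul (contMDiffAt_finsetProd fun i _ ↦ hA _ _)

/-- The solution of a nonsingular linear system with smooth coefficients is smooth. -/
theorem contMDiffAt_of_mulVec {ι : Type*} [Fintype ι] [DecidableEq ι] {A : M → Matrix ι ι ℝ}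
    {c : M → ι → ℝ} {p : M} (hA : ∀ i j, CMDiffAt ∞ (fun q ↦ A q i j) p)
    (hAc : ∀ i, CMDiffAt ∞ (fun q ↦ (A q).mulVec (c q) i) p) (hdet : (A p).det ≠ 0) (i : ι) :
    CMDiffAt ∞ (fun q ↦ c q i) p := by
  have hd := ContMDiffAt.matrix_det hA
  -- Cramer's rule expresses `c` through smooth data wherever the determinant is nonzero, which
  -- holds on a neighbourhood of `p`.
  have h1 : CMDiffAt ∞ (fun q ↦ (A q).det⁻¹ * (A q).cramer ((A q).mulVec (c q)) i) p := by
    refine (hd.inv₀ hdet).mul ?_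
    simp only [Matrix.cramer_apply]
    refine ContMDiffAt.matrix_det fun a d ↦ ?_
    by_cases h : d = i
    · subst h; simpa using hAc a
    · simpa [Matrix.updateCol_apply, h] using hA a d
  refine h1.congr_of_eventuallyEq ?_
  filter_upwards [hd.continuousAt.eventually_ne hdet] with q hq
  have : (A q).cramer ((A q).mulVec (c q)) = (A q).det • c q := by
    rw [Matrix.cramer_eq_adjugate_mulVec, Matrix.mulVec_mulVec, Matrix.adjugate_mul,
      Matrix.smul_mulVec, Matrix.one_mulVec]
  rw [this]
  simp [hq]

end Cramer

/-! ### Smoothness tested by inner products. -/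

section WeakSmoothness

variable {E : Type*} [NormedAddCommGroup E] [NormedSpace ℝ E] [FiniteDimensional ℝ E]
  {M : Type*} [TopologicalSpace M] [T2Space M] [ChartedSpace E M] [IsManifold 𝓘(ℝ, E) ∞ M]
  [RiemannianBundle (fun x : M ↦ TangentSpace 𝓘(ℝ, E) x)]
  [IsContMDiffRiemannianBundle 𝓘(ℝ, E) ∞ E (fun x : M ↦ TangentSpace 𝓘(ℝ, E) x)]

/-- A vector field is smooth if its inner products with smooth vector fields are smooth. -/
theorem isSmoothField_of_inner {S : Π x : M, TangentSpace 𝓘(ℝ, E) x}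
    (hS : ∀ Z : Π x : M, TangentSpace 𝓘(ℝ, E) x, IsSmoothField Z →
      CMDiff ∞ (fun q ↦ ⟪S q, Z q⟫_ℝ)) : IsSmoothField S := by
  classical
  intro p
  let b := Module.finBasis ℝ E
  let e := trivializationAt E (fun y : M ↦ TangentSpace 𝓘(ℝ, E) y) p
  have hp : p ∈ e.baseSet := FiberBundle.mem_baseSet_trivializationAt' p
  choose Z hZ hZe using fun i ↦ exists_isSmoothField_eventuallyEq_localFrame b p i
  have hframe := e.isLocalFrameOn_localFrame_baseSet 𝓘(ℝ, E) ∞ b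
  rw [contMDiffAt_iff_localFrameCoeff (b := b) hp]
  intro i
  -- Near `p` the frame coefficients of `S` solve the system with this Gram matrix and right-hand
  -- side `⟪S, Z j⟫`. Both are smooth, and the Gram matrix is nonsingular at `p` because the frame
  -- is independent there.
  let A : M → Matrix (Fin (Module.finrank ℝ E)) (Fin (Module.finrank ℝ E)) ℝ :=
    fun q ↦ Matrix.gram ℝ (fun a ↦ Z a q)
  refine contMDiffAt_of_mulVec (A := A)
    (c := fun q i ↦ e.localFrameCoeff 𝓘(ℝ, E) b i q (S q)) ?_ ?_ ?_ i
  · intro i j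
    exact ContMDiffAt.inner_bundle (IB := 𝓘(ℝ, E)) (F := E)
      (E := fun x : M ↦ TangentSpace 𝓘(ℝ, E) x) (b := fun q ↦ q) (hZ i p) (hZ j p)
  · intro j
    refine (hS (Z j) (hZ j) p).congr_of_eventuallyEq ?_
    filter_upwards [Filter.eventually_all.2 hZe, e.open_baseSet.mem_nhds hp] with q hq hqe
    have := e.eq_sum_localFrameCoeff_smul (I := 𝓘(ℝ, E)) (b := b) (s := S) hqe
    conv_rhs => rw [this, sum_inner]
    simp only [Matrix.mulVec, dotProduct, A, Matrix.gram_apply]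
    refine Finset.sum_congr rfl fun a _ ↦ ?_
    rw [hq a, inner_smul_left, real_inner_comm, mul_comm]
    simp [e]
  · rw [Matrix.det_gram_ne_zero_iff_linearIndependent]
    have h := hframe.linearIndependent hp
    have h2 : (fun a ↦ Z a p) = fun a ↦ e.localFrame b a p :=
      funext fun a ↦ (hZe a).self_of_nhds
    rw [h2]
    exact h

end WeakSmoothness

/-! ### The endomorphism `T` and its smoothness. -/

section TangentialEnd

variable {E : Type*} [NormedAddCommGroup E] [NormedSpace ℝ E] [FiniteDimensional ℝ E]
  {M : Type*} [TopologicalSpace M] [ChartedSpace E M] [IsManifold 𝓘(ℝ, E) ∞ M]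
  [RiemannianBundle (fun x : M ↦ TangentSpace 𝓘(ℝ, E) x)]
  {E' : Type*} [NormedAddCommGroup E'] [NormedSpace ℝ E'] [FiniteDimensional ℝ E']
  {N : Type*} [TopologicalSpace N] [ChartedSpace E' N] [IsManifold 𝓘(ℝ, E') ∞ N]
  [RiemannianBundle (fun x : N ↦ TangentSpace 𝓘(ℝ, E') x)]

theorem inner_tangentialEnd
    (φ : Π x : N, TangentSpace 𝓘(ℝ, E') x →L[ℝ] TangentSpace 𝓘(ℝ, E') x) (f : M → N) (p : M)
    (u v : TangentSpace 𝓘(ℝ, E) p) :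
    ⟪tangentialEnd φ f p u, v⟫_ℝ =
      ⟪φ (f p) (mfderiv 𝓘(ℝ, E) 𝓘(ℝ, E') f p u), mfderiv 𝓘(ℝ, E) 𝓘(ℝ, E') f p v⟫_ℝ := by
  rw [tangentialEnd, ContinuousLinearMap.comp_apply, inner_tangentialPart]
  rfl

end TangentialEnd

section Tangential

variable {E : Type*} [NormedAddCommGroup E] [NormedSpace ℝ E] [FiniteDimensional ℝ E]
  {M : Type*} [TopologicalSpace M] [T2Space M] [ChartedSpace E M] [IsManifold 𝓘(ℝ, E) ∞ M]
  [RiemannianBundle (fun x : M ↦ TangentSpace 𝓘(ℝ, E) x)]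
  [IsContMDiffRiemannianBundle 𝓘(ℝ, E) ∞ E (fun x : M ↦ TangentSpace 𝓘(ℝ, E) x)]
  {E' : Type*} [NormedAddCommGroup E'] [NormedSpace ℝ E'] [FiniteDimensional ℝ E']
  {N : Type*} [TopologicalSpace N] [ChartedSpace E' N] [IsManifold 𝓘(ℝ, E') ∞ N]
  [RiemannianBundle (fun x : N ↦ TangentSpace 𝓘(ℝ, E') x)]

theorem contMDiff_mfderiv_apply {f : M → N} (hf : ContMDiff 𝓘(ℝ, E) 𝓘(ℝ, E') ∞ f)
    {Y : Π x : M, TangentSpace 𝓘(ℝ, E) x} (hY : IsSmoothField Y) :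
    ContMDiff 𝓘(ℝ, E) (𝓘(ℝ, E').prod 𝓘(ℝ, E')) ∞ (fun q ↦ TotalSpace.mk' E'
      (E := fun x : N ↦ TangentSpace 𝓘(ℝ, E') x) (f q) (mfderiv 𝓘(ℝ, E) 𝓘(ℝ, E') f q (Y q))) :=
  (hf.contMDiff_tangentMap (m := ∞) le_rfl).comp hY

theorem IsAlmostHermitian.contMDiff_apply_mfderiv
    {φ : Π x : N, TangentSpace 𝓘(ℝ, E') x →L[ℝ] TangentSpace 𝓘(ℝ, E') x}
    (hφ : IsAlmostHermitian φ) {f : M → N} (hf : ContMDiff 𝓘(ℝ, E) 𝓘(ℝ, E') ∞ f)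
    {Y : Π x : M, TangentSpace 𝓘(ℝ, E) x} (hY : IsSmoothField Y) :
    ContMDiff 𝓘(ℝ, E) (𝓘(ℝ, E').prod 𝓘(ℝ, E')) ∞ (fun q ↦ TotalSpace.mk' E'
      (E := fun x : N ↦ TangentSpace 𝓘(ℝ, E') x) (f q)
      (φ (f q) (mfderiv 𝓘(ℝ, E) 𝓘(ℝ, E') f q (Y q)))) :=
  ContMDiff.clm_bundle_apply (hφ.smooth.comp hf) (contMDiff_mfderiv_apply hf hY)

theorem IsAlmostHermitian.isSmoothField_apply
    {φ : Π x : N, TangentSpace 𝓘(ℝ, E') x →L[ℝ] TangentSpace 𝓘(ℝ, E') x}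
    (hφ : IsAlmostHermitian φ) {Z : Π x : N, TangentSpace 𝓘(ℝ, E') x} (hZ : IsSmoothField Z) :
    IsSmoothField (fun x ↦ φ x (Z x)) :=
  ContMDiff.clm_bundle_apply hφ.smooth hZ

/-- `T` is built from fibrewise adjoints, so its smoothness is checked weakly: `⟪TY, Z⟫ = ⟪φ df Y,
df Z⟫` involves only smooth fields along `f`. -/
theorem IsAlmostHermitian.isSmoothField_tangentialEnd
    [IsContMDiffRiemannianBundle 𝓘(ℝ, E') ∞ E' (fun x : N ↦ TangentSpace 𝓘(ℝ, E') x)]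
    {φ : Π x : N, TangentSpace 𝓘(ℝ, E') x →L[ℝ] TangentSpace 𝓘(ℝ, E') x}
    (hφ : IsAlmostHermitian φ) {f : M → N} (hf : ContMDiff 𝓘(ℝ, E) 𝓘(ℝ, E') ∞ f)
    {Y : Π x : M, TangentSpace 𝓘(ℝ, E) x} (hY : IsSmoothField Y) :
    IsSmoothField (fun q ↦ tangentialEnd φ f q (Y q)) := by
  refine isSmoothField_of_inner fun Z hZ ↦ ?_
  simp only [inner_tangentialEnd]
  exact ContMDiff.inner_bundle (IB := 𝓘(ℝ, E')) (F := E')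
    (E := fun x : N ↦ TangentSpace 𝓘(ℝ, E') x) (b := f) (hφ.contMDiff_apply_mfderiv hf hY) (contMDiff_mfderiv_apply hf hZ)

end Tangential

end SlantGeometry
namespace SlantGeometry

set_option linter.unusedSectionVars false

/-! ### Differentiable vector fields along a map. -/

section AlongCalculus

variable {E : Type*} [NormedAddCommGroup E] [NormedSpace ℝ E]
  {M : Type*} [TopologicalSpace M] [ChartedSpace E M]
  {E' : Type*} [NormedAddCommGroup E'] [NormedSpace ℝ E'] [FiniteDimensional ℝ E']
  {N : Type*} [TopologicalSpace N] [ChartedSpace E' N] [IsManifold 𝓘(ℝ, E') ∞ N]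

variable (E E') in
/-- The vector field `V` along `f` is differentiable at `p`. -/
def MDiffAlong (f : M → N) (V : Π q : M, TangentSpace 𝓘(ℝ, E') (f q)) (p : M) : Prop :=
  MDifferentiableAt 𝓘(ℝ, E) (𝓘(ℝ, E').prod 𝓘(ℝ, E')) (fun q ↦ TotalSpace.mk' E'
    (E := fun x : N ↦ TangentSpace 𝓘(ℝ, E') x) (f q) (V q)) p

variable {f : M → N} {p : M}

theorem mdiffAlong_iff {V : Π q : M, TangentSpace 𝓘(ℝ, E') (f q)} :
    MDiffAlong E E' f V p ↔ MDifferentiableAt 𝓘(ℝ, E) 𝓘(ℝ, E') f p ∧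
      MDifferentiableAt 𝓘(ℝ, E) 𝓘(ℝ, E') (fun q ↦ (trivializationAt E'
        (fun y : N ↦ TangentSpace 𝓘(ℝ, E') y) (f p) ⟨f q, V q⟩).2) p :=
  mdifferentiableAt_totalSpace (IB := 𝓘(ℝ, E')) _

theorem eventually_mem_baseSet_along (hf : MDifferentiableAt 𝓘(ℝ, E) 𝓘(ℝ, E') f p) :
    ∀ᶠ q in nhds p,
      f q ∈ (trivializationAt E' (fun y : N ↦ TangentSpace 𝓘(ℝ, E') y) (f p)).baseSet :=
  hf.continuousAt.eventually <|
    (trivializationAt E' (fun y : N ↦ TangentSpace 𝓘(ℝ, E') y) (f p)).open_baseSet.mem_nhds <|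
    FiberBundle.mem_baseSet_trivializationAt' (f p)

/-- The trivialization is fibrewise linear over its base set, which contains `f q` for `q` near `p`;
hence an equality of germs. -/
theorem eventually_trivialization_add (hf : MDifferentiableAt 𝓘(ℝ, E) 𝓘(ℝ, E') f p)
    (V W : Π q : M, TangentSpace 𝓘(ℝ, E') (f q)) :
    (fun q ↦ (trivializationAt E' (fun y : N ↦ TangentSpace 𝓘(ℝ, E') y) (f p)
        ⟨f q, V q + W q⟩).2) =ᶠ[nhds p]
      (fun q ↦ (trivializationAt E' (fun y : N ↦ TangentSpace 𝓘(ℝ, E') y) (f p) ⟨f q, V q⟩).2) +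
      fun q ↦ (trivializationAt E' (fun y : N ↦ TangentSpace 𝓘(ℝ, E') y) (f p) ⟨f q, W q⟩).2 := by
  filter_upwards [eventually_mem_baseSet_along hf] with q hq
  exact ((trivializationAt E' (fun y : N ↦ TangentSpace 𝓘(ℝ, E') y) (f p)).linear ℝ hq).map_add _ _

theorem eventually_trivialization_smul (hf : MDifferentiableAt 𝓘(ℝ, E) 𝓘(ℝ, E') f p)
    (g : M → ℝ) (V : Π q : M, TangentSpace 𝓘(ℝ, E') (f q)) :
    (fun q ↦ (trivializationAt E' (fun y : N ↦ TangentSpace 𝓘(ℝ, E') y) (f p)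
        ⟨f q, g q • V q⟩).2) =ᶠ[nhds p]
      g • fun q ↦ (trivializationAt E' (fun y : N ↦ TangentSpace 𝓘(ℝ, E') y) (f p)
        ⟨f q, V q⟩).2 := by
  filter_upwards [eventually_mem_baseSet_along hf] with q hq
  exact ((trivializationAt E' (fun y : N ↦ TangentSpace 𝓘(ℝ, E') y) (f p)).linear ℝ hq).map_smul _ _

theorem MDiffAlong.congr {V W : Π q : M, TangentSpace 𝓘(ℝ, E') (f q)}
    (hV : MDiffAlong E E' f V p) (h : ∀ᶠ q in nhds p, V q = W q) : MDiffAlong E E' f W p := by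
  refine MDifferentiableAt.congr_of_eventuallyEq hV ?_
  filter_upwards [h] with q hq
  rw [hq]

theorem MDiffAlong.add {V W : Π q : M, TangentSpace 𝓘(ℝ, E') (f q)}
    (hV : MDiffAlong E E' f V p) (hW : MDiffAlong E E' f W p) :
    MDiffAlong E E' f (fun q ↦ V q + W q) p := by
  rw [mdiffAlong_iff] at hV hW ⊢
  exact ⟨hV.1, (hV.2.add hW.2).congr_of_eventuallyEq (eventually_trivialization_add hV.1 V W)⟩

theorem MDiffAlong.smul {g : M → ℝ} {V : Π q : M, TangentSpace 𝓘(ℝ, E') (f q)}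
    (hg : MDifferentiableAt 𝓘(ℝ, E) 𝓘(ℝ, ℝ) g p) (hV : MDiffAlong E E' f V p) :
    MDiffAlong E E' f (fun q ↦ g q • V q) p := by
  rw [mdiffAlong_iff] at hV ⊢
  exact ⟨hV.1, (hg.smul hV.2).congr_of_eventuallyEq (eventually_trivialization_smul hV.1 g V)⟩

theorem mdiffAlong_comp (hf : MDifferentiableAt 𝓘(ℝ, E) 𝓘(ℝ, E') f p)
    {Z : Π x : N, TangentSpace 𝓘(ℝ, E') x} (hZ : IsSmoothField Z) :
    MDiffAlong E E' f (fun q ↦ Z (f q)) p :=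
  MDifferentiableAt.comp (g := T% Z) p ((hZ (f p)).mdifferentiableAt (by simp)) hf

/-- To prove a property of all differentiable vector fields along `f`, it suffices to prove it for
restrictions of smooth vector fields, and to check that it is local and respects sums and
multiplication by functions. -/
theorem MDiffAlong.induction [T2Space N] {P : (Π q : M, TangentSpace 𝓘(ℝ, E') (f q)) → Prop}
    (congr : ∀ V W, (∀ᶠ q in nhds p, V q = W q) → P V → P W)
    (add : ∀ V W, MDiffAlong E E' f V p → MDiffAlong E E' f W p → P V → P W →
      P (fun q ↦ V q + W q))
    (smul : ∀ (g : M → ℝ) V, MDifferentiableAt 𝓘(ℝ, E) 𝓘(ℝ, ℝ) g p → MDiffAlong E E' f V p →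
      P V → P (fun q ↦ g q • V q))
    (comp : ∀ Z : Π x : N, TangentSpace 𝓘(ℝ, E') x, IsSmoothField Z → P (fun q ↦ Z (f q)))
    {V : Π q : M, TangentSpace 𝓘(ℝ, E') (f q)} (hV : MDiffAlong E E' f V p) : P V := by
  classical
  have hf := (mdiffAlong_iff.1 hV).1
  have hc := (mdiffAlong_iff.1 hV).2
  let b := Module.finBasis ℝ E'
  set e := trivializationAt E' (fun y : N ↦ TangentSpace 𝓘(ℝ, E') y) (f p) with he
  choose Z hZ hZe using fun i ↦ exists_isSmoothField_eventuallyEq_localFrame b (f p) i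
  -- The coordinates of `V` in the chart frame at `f p`: near `p`, `V = ∑ c i • (Z i ∘ f)`.
  let c : Fin (Module.finrank ℝ E') → M → ℝ := fun i q ↦ b.repr (e ⟨f q, V q⟩).2 i
  have hcd : ∀ i, MDifferentiableAt 𝓘(ℝ, E) 𝓘(ℝ, ℝ) (c i) p := by
    intro i
    let ℓ : E' →L[ℝ] ℝ := LinearMap.toContinuousLinearMap (b.coord i)
    exact ℓ.mdifferentiableAt.comp p hc
  -- Differentiability of the partial sums travels with `P`, since the hypothesis `add` asks for it.
  have hsum : ∀ s : Finset (Fin (Module.finrank ℝ E')),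
      MDiffAlong E E' f (fun q ↦ ∑ i ∈ s, c i q • Z i (f q)) p ∧
        P (fun q ↦ ∑ i ∈ s, c i q • Z i (f q)) := by
    intro s
    induction s using Finset.induction_on with
    | empty =>
      have h0 : IsSmoothField (0 : Π x : N, TangentSpace 𝓘(ℝ, E') x) :=
        contMDiff_zeroSection ℝ (fun x : N ↦ TangentSpace 𝓘(ℝ, E') x)
      exact ⟨mdiffAlong_comp hf h0, comp 0 h0⟩
    | insert i s hi ih =>
      simp only [Finset.sum_insert hi]
      have hd := mdiffAlong_comp hf (hZ i)
      exact ⟨(MDiffAlong.smul (hcd i) hd).add ih.1,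
        add _ _ (MDiffAlong.smul (hcd i) hd) ih.1 (smul _ _ (hcd i) hd (comp _ (hZ i))) ih.2⟩
  refine congr _ _ ?_ (hsum Finset.univ).2
  filter_upwards [eventually_mem_baseSet_along hf,
    hf.continuousAt.eventually (Filter.eventually_all.2 hZe)] with q hq hZq
  have h := (e.basisAt b hq).sum_repr (V q)
  conv_rhs => rw [← h]
  refine Finset.sum_congr rfl fun i _ ↦ ?_
  rw [hZq i, Trivialization.localFrame_apply_of_mem_baseSet _ _ hq]
  rfl

end AlongCalculus

/-! ### Covariant differentiation along a map. -/

section AlongConnection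

variable {E : Type*} [NormedAddCommGroup E] [NormedSpace ℝ E]
  {M : Type*} [TopologicalSpace M] [ChartedSpace E M]
  {E' : Type*} [NormedAddCommGroup E'] [NormedSpace ℝ E'] [FiniteDimensional ℝ E']
  {N : Type*} [TopologicalSpace N] [ChartedSpace E' N] [IsManifold 𝓘(ℝ, E') ∞ N]
  [RiemannianBundle (fun x : N ↦ TangentSpace 𝓘(ℝ, E') x)]
  [IsContMDiffRiemannianBundle 𝓘(ℝ, E') ∞ E' (fun x : N ↦ TangentSpace 𝓘(ℝ, E') x)]
  {f : M → N} {p : M}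

theorem mvfderiv_congr {F : Type*} [NormedAddCommGroup F] [NormedSpace ℝ F] {g h : M → F}
    (H : g =ᶠ[nhds p] h) : mvfderiv 𝓘(ℝ, E) g p = mvfderiv 𝓘(ℝ, E) h p := by
  have h0 : g p = h p := H.self_of_nhds
  have := Filter.EventuallyEq.mfderiv_eq (I := 𝓘(ℝ, E)) (I' := 𝓘(ℝ, F)) H
  ext v
  simp only [mvfderiv]
  rw [this, h0]

theorem nablaAlong_congr {V W : Π q : M, TangentSpace 𝓘(ℝ, E') (f q)}
    (h : ∀ᶠ q in nhds p, V q = W q) (u : TangentSpace 𝓘(ℝ, E) p) :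
    nablaAlong f V p u = nablaAlong f W p u := by
  have h1 : mvfderiv 𝓘(ℝ, E) (fun q ↦ (trivializationAt E'
      (fun y : N ↦ TangentSpace 𝓘(ℝ, E') y) (f p) ⟨f q, V q⟩).2) p
      = mvfderiv 𝓘(ℝ, E) (fun q ↦ (trivializationAt E'
      (fun y : N ↦ TangentSpace 𝓘(ℝ, E') y) (f p) ⟨f q, W q⟩).2) p := by
    apply mvfderiv_congr
    filter_upwards [h] with q hq
    rw [hq]
  rw [nablaAlong, nablaAlong, h1, h.self_of_nhds]

/-- The extension of a vector is constant in the trivialization, so near `x` it depends linearly on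
the vector, and the connection is local. This handles the second term of `nablaAlong`. -/
theorem leviCivita_extend_add {x : N} (v w : TangentSpace 𝓘(ℝ, E') x) :
    leviCivita (FiberBundle.extend E' (v + w)) x =
      leviCivita (FiberBundle.extend E' v) x + leviCivita (FiberBundle.extend E' w) x := by
  have hd := fun u : TangentSpace 𝓘(ℝ, E') x ↦ FiberBundle.mdifferentiableAt_extend 𝓘(ℝ, E') E' u
  set e := trivializationAt E' (fun y : N ↦ TangentSpace 𝓘(ℝ, E') y) x with he
  have hx : x ∈ e.baseSet := FiberBundle.mem_baseSet_trivializationAt' x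
  rw [← leviCivita.isCovariantDerivativeOnUniv.add (hd v) (hd w)]
  refine leviCivita.isCovariantDerivativeOnUniv.congr_of_eventuallyEq (hd _)
    (mdifferentiableAt_add_section (hd v) (hd w)) Filter.univ_mem ?_
  filter_upwards [e.open_baseSet.mem_nhds hx] with y hy
  change e.symm y (e ⟨x, v + w⟩).2 = e.symm y (e ⟨x, v⟩).2 + e.symm y (e ⟨x, w⟩).2
  rw [(e.linear ℝ hx).map_add v w, ← e.coe_symmₗ (R := ℝ) hy, map_add]

theorem leviCivita_extend_smul {x : N} (a : ℝ) (v : TangentSpace 𝓘(ℝ, E') x) :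
    leviCivita (FiberBundle.extend E' (a • v)) x =
      a • leviCivita (FiberBundle.extend E' v) x := by
  have hd := fun u : TangentSpace 𝓘(ℝ, E') x ↦ FiberBundle.mdifferentiableAt_extend 𝓘(ℝ, E') E' u
  set e := trivializationAt E' (fun y : N ↦ TangentSpace 𝓘(ℝ, E') y) x with he
  have hx : x ∈ e.baseSet := FiberBundle.mem_baseSet_trivializationAt' x
  rw [← leviCivita.isCovariantDerivativeOnUniv.smul_const a (hd v)]
  refine leviCivita.isCovariantDerivativeOnUniv.congr_of_eventuallyEq (hd _)
    (mdifferentiableAt_const.smul_section (hd v)) Filter.univ_mem ?_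
  filter_upwards [e.open_baseSet.mem_nhds hx] with y hy
  change e.symm y (e ⟨x, a • v⟩).2 = a • e.symm y (e ⟨x, v⟩).2
  rw [(e.linear ℝ hx).map_smul a v, ← e.coe_symmₗ (R := ℝ) hy, map_smul]

theorem nablaAlong_add {V W : Π q : M, TangentSpace 𝓘(ℝ, E') (f q)}
    (hV : MDiffAlong E E' f V p) (hW : MDiffAlong E E' f W p) (u : TangentSpace 𝓘(ℝ, E) p) :
    nablaAlong f (fun q ↦ V q + W q) p u = nablaAlong f V p u + nablaAlong f W p u := by
  rw [mdiffAlong_iff] at hV hW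
  rw [nablaAlong, nablaAlong, nablaAlong, mvfderiv_congr (eventually_trivialization_add hV.1 V W),
    mvfderiv_add hV.2 hW.2, leviCivita_extend_add]
  set e := trivializationAt E' (fun y : N ↦ TangentSpace 𝓘(ℝ, E') y) (f p) with he
  have hx : f p ∈ e.baseSet := FiberBundle.mem_baseSet_trivializationAt' (f p)
  rw [← e.coe_symmₗ (R := ℝ) hx]
  simp only [_root_.add_apply, map_add]
  abel

theorem nablaAlong_smul {g : M → ℝ} {V : Π q : M, TangentSpace 𝓘(ℝ, E') (f q)}
    (hg : MDifferentiableAt 𝓘(ℝ, E) 𝓘(ℝ, ℝ) g p) (hV : MDiffAlong E E' f V p)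
    (u : TangentSpace 𝓘(ℝ, E) p) :
    nablaAlong f (fun q ↦ g q • V q) p u =
      g p • nablaAlong f V p u + mvfderiv 𝓘(ℝ, E) g p u • V p := by
  rw [mdiffAlong_iff] at hV
  rw [nablaAlong, nablaAlong, mvfderiv_congr (eventually_trivialization_smul hV.1 g V),
    mvfderiv_smul hg hV.2, leviCivita_extend_smul]
  set e := trivializationAt E' (fun y : N ↦ TangentSpace 𝓘(ℝ, E') y) (f p) with he
  have hx : f p ∈ e.baseSet := FiberBundle.mem_baseSet_trivializationAt' (f p)
  have hinv : e.symmₗ ℝ (f p) (e ⟨f p, V p⟩).2 = V p := by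
    rw [e.coe_symmₗ (R := ℝ) hx]
    exact e.symm_apply_apply_mk hx (V p)
  rw [← e.coe_symmₗ (R := ℝ) hx]
  simp only [_root_.add_apply, _root_.smul_apply, ContinuousLinearMap.smulRight_apply, map_add,
    map_smul, hinv]
  module

/-- A parallel `φ` on `N` commutes with covariant differentiation along `f`. -/
theorem IsKahler.nablaAlong_apply [T2Space N]
    {φ : Π x : N, TangentSpace 𝓘(ℝ, E') x →L[ℝ] TangentSpace 𝓘(ℝ, E') x} (hφ : IsKahler φ)
    {V : Π q : M, TangentSpace 𝓘(ℝ, E') (f q)} (hV : MDiffAlong E E' f V p)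
    (u : TangentSpace 𝓘(ℝ, E) p) :
    nablaAlong f (fun q ↦ φ (f q) (V q)) p u = φ (f p) (nablaAlong f V p u) := by
  have hf := (mdiffAlong_iff.1 hV).1
  have hφd : ∀ {W : Π q : M, TangentSpace 𝓘(ℝ, E') (f q)}, MDiffAlong E E' f W p →
      MDiffAlong E E' f (fun q ↦ φ (f q) (W q)) p := fun hW ↦
    MDifferentiableAt.clm_bundle_apply
      (((hφ.smooth (f p)).mdifferentiableAt (by simp)).comp p hf) hW
  -- Both sides are local, additive and obey the same Leibniz rule in `V`, so only restrictions of
  -- ambient fields remain.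
  refine MDiffAlong.induction
    (P := fun V ↦ nablaAlong f (fun q ↦ φ (f q) (V q)) p u = φ (f p) (nablaAlong f V p u))
    ?_ ?_ ?_ ?_ hV
  · intro V W h hP
    rw [← nablaAlong_congr h, ← hP]
    refine (nablaAlong_congr ?_ u).symm
    filter_upwards [h] with q hq
    rw [hq]
  · intro V W hV hW hPV hPW
    simp only [map_add]
    rw [nablaAlong_add (hφd hV) (hφd hW), nablaAlong_add hV hW, hPV, hPW, map_add]
  · intro g V hg hV hP
    simp only [map_smul]
    rw [nablaAlong_smul hg (hφd hV), nablaAlong_smul hg hV, hP, map_add, map_smul, map_smul]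
  · intro Z hZ
    -- Parallelism of `φ` is stated for global fields, so the direction `df u` is extended to one.
    obtain ⟨X, hX, hXu⟩ :=
      exists_isSmoothField_apply_eq (f p) (mfderiv 𝓘(ℝ, E) 𝓘(ℝ, E') f p u)
    have h1 := nablaAlong_comp hf ((hφ.isSmoothField_apply hZ (f p)).mdifferentiableAt (by simp)) u
    rw [h1, nablaAlong_comp hf ((hZ (f p)).mdifferentiableAt (by simp)) u, ← hXu]
    exact hφ.parallel X Z hX hZ (f p)

theorem MDiffAlong.inner {V W : Π q : M, TangentSpace 𝓘(ℝ, E') (f q)}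
    (hV : MDiffAlong E E' f V p) (hW : MDiffAlong E E' f W p) :
    MDifferentiableAt 𝓘(ℝ, E) 𝓘(ℝ, ℝ) (fun q ↦ ⟪V q, W q⟫_ℝ) p :=
  MDifferentiableAt.inner_bundle (IB := 𝓘(ℝ, E')) (F := E')
    (E := fun x : N ↦ TangentSpace 𝓘(ℝ, E') x) (b := f) hV hW

/-- Covariant differentiation along `f` is compatible with the metric. -/
theorem mvfderiv_inner_along [T2Space N] {V W : Π q : M, TangentSpace 𝓘(ℝ, E') (f q)}
    (hV : MDiffAlong E E' f V p) (hW : MDiffAlong E E' f W p) (u : TangentSpace 𝓘(ℝ, E) p) :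
    mvfderiv 𝓘(ℝ, E) (fun q ↦ ⟪V q, W q⟫_ℝ) p u =
      ⟪nablaAlong f V p u, W p⟫_ℝ + ⟪V p, nablaAlong f W p u⟫_ℝ := by
  have hf := (mdiffAlong_iff.1 hV).1
  -- Reduces the first argument to a restricted field. Used twice, with the arguments swapped by
  -- symmetry, it leaves two ambient fields, for which metric compatibility on `N` and the chain
  -- rule suffice.
  have reduce : ∀ {V W : Π q : M, TangentSpace 𝓘(ℝ, E') (f q)},
      MDiffAlong E E' f V p → MDiffAlong E E' f W p →
      (∀ Z : Π x : N, TangentSpace 𝓘(ℝ, E') x, IsSmoothField Z →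
        mvfderiv 𝓘(ℝ, E) (fun q ↦ ⟪Z (f q), W q⟫_ℝ) p u =
          ⟪nablaAlong f (fun q ↦ Z (f q)) p u, W p⟫_ℝ + ⟪Z (f p), nablaAlong f W p u⟫_ℝ) →
      mvfderiv 𝓘(ℝ, E) (fun q ↦ ⟪V q, W q⟫_ℝ) p u =
        ⟪nablaAlong f V p u, W p⟫_ℝ + ⟪V p, nablaAlong f W p u⟫_ℝ := by
    intro V W hV hW hZ
    refine MDiffAlong.induction
      (P := fun V ↦ mvfderiv 𝓘(ℝ, E) (fun q ↦ ⟪V q, W q⟫_ℝ) p u =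
        ⟪nablaAlong f V p u, W p⟫_ℝ + ⟪V p, nablaAlong f W p u⟫_ℝ) ?_ ?_ ?_ hZ hV
    · intro V V' h hP
      rw [← nablaAlong_congr h, ← h.self_of_nhds, ← hP]
      refine congr($(mvfderiv_congr ?_) u)
      filter_upwards [h] with q hq
      rw [hq]
    · intro V V' hV hV' hPV hPV'
      simp only [inner_add_left]
      rw [mvfderiv_fun_add (hV.inner hW) (hV'.inner hW), nablaAlong_add hV hV', _root_.add_apply,
        hPV, hPV', inner_add_left]
      ring
    · intro g V hg hV hP
      simp only [real_inner_smul_left]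
      rw [mvfderiv_fun_mul hg (hV.inner hW), nablaAlong_smul hg hV]
      simp only [_root_.add_apply, _root_.smul_apply, hP, inner_add_left, real_inner_smul_left,
        smul_eq_mul]
      ring
  refine reduce hV hW fun Z hZ ↦ ?_
  have h := reduce hW (mdiffAlong_comp hf hZ) fun Y hY ↦ ?_
  · simp only [real_inner_comm] at h ⊢
    rw [h]
    ring
  · have hYd : MDiffAt (T% Y) (f p) := (hY (f p)).mdifferentiableAt (by simp)
    have hZd : MDiffAt (T% Z) (f p) := (hZ (f p)).mdifferentiableAt (by simp)
    rw [nablaAlong_comp hf hYd, nablaAlong_comp hf hZd,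
      ← isLeviCivita_leviCivita.metric Y Z (f p) hYd hZd]
    exact mvfderiv_comp_apply (I := 𝓘(ℝ, E')) (I' := 𝓘(ℝ, E)) p (mdiff_inner hYd hZd) hf u

end AlongConnection

end SlantGeometry
namespace SlantGeometry

set_option linter.unusedSectionVars false

/-! ### Slant angles and the linear algebra of `T`. -/

section Angle

variable {V : Type*} [NormedAddCommGroup V] [InnerProductSpace ℝ V]

theorem angleWithSubspace_eq_pi_div_two {w : V} {S : Submodule ℝ V} [S.HasOrthogonalProjection]
    (h : S.starProjection w = 0) : angleWithSubspace w S = Real.pi / 2 := by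
  rw [angleWithSubspace, h, InnerProductGeometry.angle_zero_right]

theorem angleWithSubspace_eq_zero {w : V} {S : Submodule ℝ V} [S.HasOrthogonalProjection]
    (hw : w ≠ 0) (h : S.starProjection w = w) : angleWithSubspace w S = 0 := by
  rw [angleWithSubspace, h, InnerProductGeometry.angle_self hw]

end Angle

section TangentialEnd

variable {E : Type*} [NormedAddCommGroup E] [NormedSpace ℝ E] [FiniteDimensional ℝ E]
  {M : Type*} [TopologicalSpace M] [ChartedSpace E M] [IsManifold 𝓘(ℝ, E) ∞ M]
  [RiemannianBundle (fun x : M ↦ TangentSpace 𝓘(ℝ, E) x)]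
  {E' : Type*} [NormedAddCommGroup E'] [NormedSpace ℝ E'] [FiniteDimensional ℝ E']
  {N : Type*} [TopologicalSpace N] [ChartedSpace E' N] [IsManifold 𝓘(ℝ, E') ∞ N]
  [RiemannianBundle (fun x : N ↦ TangentSpace 𝓘(ℝ, E') x)]
  {φ : Π x : N, TangentSpace 𝓘(ℝ, E') x →L[ℝ] TangentSpace 𝓘(ℝ, E') x} {f : M → N}

theorem IsAlmostHermitian.inner_apply_left (hφ : IsAlmostHermitian φ) (x : N)
    (u v : TangentSpace 𝓘(ℝ, E') x) : ⟪φ x u, v⟫_ℝ = -⟪u, φ x v⟫_ℝ := by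
  have h := hφ.inner_map x u (φ x v)
  rw [hφ.sq, inner_neg_right] at h
  linarith

/-- `T` is a compression of `φ`, so it inherits skew-symmetry. -/
theorem IsAlmostHermitian.inner_tangentialEnd_left (hφ : IsAlmostHermitian φ) (p : M)
    (u v : TangentSpace 𝓘(ℝ, E) p) :
    ⟪tangentialEnd φ f p u, v⟫_ℝ = -⟪u, tangentialEnd φ f p v⟫_ℝ := by
  rw [inner_tangentialEnd, hφ.inner_apply_left, real_inner_comm, ← inner_tangentialEnd,
    real_inner_comm]

/-- If `T u` lies in `D_p`, then it is the orthogonal projection of `φ u` to `D_p`. -/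
theorem starProjection_ambientImage (hf : IsRiemannianSubmanifold E E' f) {p : M}
    {S : Submodule ℝ (TangentSpace 𝓘(ℝ, E) p)} {u : TangentSpace 𝓘(ℝ, E) p}
    (hu : tangentialEnd φ f p u ∈ S) :
    (ambientImage f p S).starProjection (φ (f p) (mfderiv 𝓘(ℝ, E) 𝓘(ℝ, E') f p u)) =
      mfderiv 𝓘(ℝ, E) 𝓘(ℝ, E') f p (tangentialEnd φ f p u) := by
  apply Submodule.eq_starProjection_of_mem_of_inner_eq_zero
  · exact ⟨_, hu, rfl⟩
  · rintro _ ⟨v, -, rfl⟩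
    rw [inner_sub_left]
    exact sub_eq_zero.2 ((inner_tangentialEnd φ f p u v).symm.trans (hf.inner_map p _ v).symm)

/-- On an invariant distribution, `T` is the restriction of `φ`. -/
theorem IsInvariantDistribution.mfderiv_tangentialEnd
    {D : Π x : M, Submodule ℝ (TangentSpace 𝓘(ℝ, E) x)} (hD : IsInvariantDistribution φ f D)
    (hf : IsRiemannianSubmanifold E E' f) {p : M} {u : TangentSpace 𝓘(ℝ, E) p} (hu : u ∈ D p) :
    tangentialEnd φ f p u ∈ D p ∧ mfderiv 𝓘(ℝ, E) 𝓘(ℝ, E') f p (tangentialEnd φ f p u) =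
      φ (f p) (mfderiv 𝓘(ℝ, E) 𝓘(ℝ, E') f p u) := by
  obtain ⟨w, hw, hwu⟩ := hD p u hu
  have hwu' : mfderiv 𝓘(ℝ, E) 𝓘(ℝ, E') f p w = φ (f p) (mfderiv 𝓘(ℝ, E) 𝓘(ℝ, E') f p u) := hwu
  have : tangentialEnd φ f p u = w := by
    refine ext_inner_right ℝ fun v ↦ ?_
    rw [inner_tangentialEnd, ← hwu', hf.inner_map]
  rw [this]
  exact ⟨hw, hwu'⟩

/-- On an invariant distribution, `T² = -I`. -/
theorem IsInvariantDistribution.tangentialEnd_tangentialEnd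
    {D : Π x : M, Submodule ℝ (TangentSpace 𝓘(ℝ, E) x)} (hD : IsInvariantDistribution φ f D)
    (hφ : IsAlmostHermitian φ) (hf : IsRiemannianSubmanifold E E' f) {p : M}
    {u : TangentSpace 𝓘(ℝ, E) p} (hu : u ∈ D p) :
    tangentialEnd φ f p (tangentialEnd φ f p u) = -u := by
  obtain ⟨h1, h2⟩ := hD.mfderiv_tangentialEnd hf hu
  apply hf.immersion p
  rw [(hD.mfderiv_tangentialEnd hf h1).2, h2, hφ.sq, map_neg]

variable {k : ℕ} {D : Fin (k + 1) → Π x : M, Submodule ℝ (TangentSpace 𝓘(ℝ, E) x)}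
  {θ : Fin (k + 1) → M → ℝ}

namespace IsPointwiseKSlant

theorem tangentialEnd_mem (hD : IsPointwiseKSlant φ f k D θ)
    (hf : IsRiemannianSubmanifold E E' f) (i : Fin (k + 1)) {p : M} {u : TangentSpace 𝓘(ℝ, E) p}
    (hu : u ∈ D i p) : tangentialEnd φ f p u ∈ D i p := by
  by_cases hi : i = 0
  · subst hi
    exact (hD.invariant.mfderiv_tangentialEnd hf hu).1
  · exact hD.tangential_mem i hi p u hu

/-- `T` is injective on `D i` where the slant function is not `π / 2`. -/
theorem eq_zero_of_tangentialEnd_eq_zero (hD : IsPointwiseKSlant φ f k D θ)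
    (hφ : IsAlmostHermitian φ) (hf : IsRiemannianSubmanifold E E' f) {i : Fin (k + 1)} {p : M}
    (hi : θ i p ≠ Real.pi / 2) {u : TangentSpace 𝓘(ℝ, E) p} (hu : u ∈ D i p)
    (hTu : tangentialEnd φ f p u = 0) : u = 0 := by
  by_cases h0 : i = 0
  · subst h0
    have h := hD.invariant.tangentialEnd_tangentialEnd hφ hf hu
    rw [hTu, map_zero] at h
    exact neg_eq_zero.1 h.symm
  · by_contra hne
    refine hi (((hD.slant i h0 p).2 u hu hne).symm.trans (angleWithSubspace_eq_pi_div_two ?_))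
    rw [starProjection_ambientImage hf (hD.tangentialEnd_mem hf i hu), hTu, map_zero]

/-- No proper slant distribution contains an eigenvector of `T²` for the eigenvalue `-1`. -/
theorem eq_zero_of_tangentialEnd_sq (hD : IsPointwiseKSlant φ f k D θ)
    (hφ : IsAlmostHermitian φ) (hf : IsRiemannianSubmanifold E E' f) {i : Fin (k + 1)} (hi : i ≠ 0)
    {p : M} {u : TangentSpace 𝓘(ℝ, E) p} (hu : u ∈ D i p)
    (hTu : tangentialEnd φ f p (tangentialEnd φ f p u) = -u) : u = 0 := by
  by_contra hne
  have hproj := starProjection_ambientImage hf (φ := φ) (hD.tangentialEnd_mem hf i hu)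
  -- Skew-symmetry and `T² u = -u` give `|T u| = |u| = |φ u|`. As `T u` is the tangential projection
  -- of `φ u`, `|T u - φ u|² = |T u|² - 2|T u|² + |φ u|² = 0`.
  have hmap : mfderiv 𝓘(ℝ, E) 𝓘(ℝ, E') f p (tangentialEnd φ f p u) =
      φ (f p) (mfderiv 𝓘(ℝ, E) 𝓘(ℝ, E') f p u) := by
    have h1 : ⟪tangentialEnd φ f p u, tangentialEnd φ f p u⟫_ℝ = ⟪u, u⟫_ℝ := by
      rw [hφ.inner_tangentialEnd_left, hTu, inner_neg_right, neg_neg]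
    have h2 := inner_tangentialEnd φ f p u (tangentialEnd φ f p u)
    have h3 := hφ.inner_map (f p) (mfderiv 𝓘(ℝ, E) 𝓘(ℝ, E') f p u)
      (mfderiv 𝓘(ℝ, E) 𝓘(ℝ, E') f p u)
    rw [hf.inner_map] at h3
    rw [← sub_eq_zero, ← inner_self_eq_zero (𝕜 := ℝ), real_inner_sub_sub_self, hf.inner_map,
      real_inner_comm (φ (f p) (mfderiv 𝓘(ℝ, E) 𝓘(ℝ, E') f p u)), ← h2, h3, h1]
    ring
  -- Needed because the angle of the zero vector with itself is `π / 2` by convention, not `0`.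
  have hw : φ (f p) (mfderiv 𝓘(ℝ, E) 𝓘(ℝ, E') f p u) ≠ 0 := by
    intro h0
    have h := hφ.sq (f p) (mfderiv 𝓘(ℝ, E) 𝓘(ℝ, E') f p u)
    rw [h0, map_zero, eq_comm, neg_eq_zero] at h
    exact hne (hf.immersion p (h.trans (map_zero _).symm))
  refine (hD.slant i hi p).1 (((hD.slant i hi p).2 u hu hne).symm.trans
    (angleWithSubspace_eq_zero hw ?_))
  rw [hproj, hmap]

end IsPointwiseKSlant

/-- For an internal direct sum of subspaces invariant under `A`, if `A` is injective on all
summands but the `i`-th one, then `A u` belongs to the `i`-th summand only if `u` does. -/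
theorem mem_of_apply_mem_of_isInternal {ι V : Type*} [DecidableEq ι] [AddCommGroup V] [Module ℝ V]
    {S : ι → Submodule ℝ V} (hS : DirectSum.IsInternal S) {A : V →ₗ[ℝ] V}
    (hA : ∀ j, ∀ u ∈ S j, A u ∈ S j) {i : ι}
    (hinj : ∀ j, j ≠ i → ∀ u ∈ S j, A u = 0 → u = 0) {u : V} (hu : A u ∈ S i) : u ∈ S i := by
  classical
  let Q : DirectSum ι (fun j ↦ S j) ≃ₗ[ℝ] V :=
    LinearEquiv.ofBijective (DirectSum.coeLinearMap S) hS
  -- Invariance of the summands makes `A` commute with the component projections, so for `j ≠ i` the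
  -- `j`-th component of `u` is killed by `A`.
  have hcomp : ∀ (j : ι) (w : V), ((Q.symm (A w)) j : V) = A (Q.symm w j) := by
    intro j w
    obtain ⟨x, rfl⟩ := Q.surjective w
    rw [Q.symm_apply_apply]
    induction x using DirectSum.induction_on with
    | zero => simp
    | of l y =>
      have h1 : Q (DirectSum.of (fun j ↦ S j) l y) = y := DirectSum.coeLinearMap_of S l y
      have h2 : A y = Q (DirectSum.of (fun j ↦ S j) l ⟨A y, hA l y y.2⟩) :=
        (DirectSum.coeLinearMap_of S l ⟨A y, hA l y y.2⟩).symm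
      rw [h1, h2, Q.symm_apply_apply]
      by_cases hl : l = j
      · subst hl; simp
      · rw [DirectSum.of_eq_of_ne _ _ _ (Ne.symm hl), DirectSum.of_eq_of_ne _ _ _ (Ne.symm hl)]
        simp
    | add x y hx hy => simp [hx, hy]
  have hzero : ∀ j, j ≠ i → ((Q.symm u) j : V) = 0 := by
    intro j hj
    refine hinj j hj _ (Q.symm u j).2 ?_
    rw [← hcomp]
    have h : A u = Q (DirectSum.of (fun j ↦ S j) i ⟨A u, hu⟩) :=
      (DirectSum.coeLinearMap_of S i ⟨A u, hu⟩).symm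
    rw [h, Q.symm_apply_apply, DirectSum.of_eq_of_ne _ _ _ hj]
    rfl
  have h : Q.symm u = DirectSum.of (fun j ↦ S j) i (Q.symm u i) := by
    ext j
    by_cases hj : j = i
    · subst hj; simp
    · rw [DirectSum.of_eq_of_ne _ _ _ hj, hzero j hj]
      rfl
  have h2 : u = ((Q.symm u i : S i) : V) := by
    conv_lhs => rw [← Q.apply_symm_apply u, h]
    exact DirectSum.coeLinearMap_of S i _
  rw [h2]
  exact (Q.symm u i).2

end TangentialEnd

/-! ### Parallelism of `T` on totally geodesic submanifolds. -/

section TotallyGeodesic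

variable {E : Type*} [NormedAddCommGroup E] [NormedSpace ℝ E] [FiniteDimensional ℝ E]
  {M : Type*} [TopologicalSpace M] [T2Space M] [ChartedSpace E M] [IsManifold 𝓘(ℝ, E) ∞ M]
  [RiemannianBundle (fun x : M ↦ TangentSpace 𝓘(ℝ, E) x)]
  [IsContMDiffRiemannianBundle 𝓘(ℝ, E) ∞ E (fun x : M ↦ TangentSpace 𝓘(ℝ, E) x)]
  {E' : Type*} [NormedAddCommGroup E'] [NormedSpace ℝ E'] [FiniteDimensional ℝ E']
  {N : Type*} [TopologicalSpace N] [T2Space N] [ChartedSpace E' N] [IsManifold 𝓘(ℝ, E') ∞ N]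
  [RiemannianBundle (fun x : N ↦ TangentSpace 𝓘(ℝ, E') x)]
  [IsContMDiffRiemannianBundle 𝓘(ℝ, E') ∞ E' (fun x : N ↦ TangentSpace 𝓘(ℝ, E') x)]
  {φ : Π x : N, TangentSpace 𝓘(ℝ, E') x →L[ℝ] TangentSpace 𝓘(ℝ, E') x} {f : M → N}

theorem IsSmoothField.mdifferentiableAt {X : Π x : M, TangentSpace 𝓘(ℝ, E) x}
    (hX : IsSmoothField X) (p : M) : MDiffAt (T% X) p :=
  (hX p).mdifferentiableAt (by simp)

theorem IsSmoothField.mlieBracket {X Y : Π x : M, TangentSpace 𝓘(ℝ, E) x}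
    (hX : IsSmoothField X) (hY : IsSmoothField Y) :
    IsSmoothField (mlieBracket 𝓘(ℝ, E) X Y) := by
  intro p
  have : CompleteSpace E := FiniteDimensional.complete ℝ E
  have : IsManifold 𝓘(ℝ, E) (minSmoothness ℝ 2) M :=
    IsManifold.of_le (n := ∞) (by
      rw [minSmoothness_of_isRCLikeNormedField]; exact WithTop.coe_le_coe.2 le_top)
  have : IsManifold 𝓘(ℝ, E) (((⊤ : ℕ∞) : WithTop ℕ∞) + 1) M :=
    inferInstanceAs (IsManifold 𝓘(ℝ, E) ∞ M)
  exact ContMDiffAt.mlieBracket_vectorField (m := ⊤) (n := ⊤) (hX p) (hY p) (by simp)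

theorem nabla_sub_nabla {X Y : Π x : M, TangentSpace 𝓘(ℝ, E) x}
    (hX : IsSmoothField X) (hY : IsSmoothField Y) (p : M) :
    nabla X Y p - nabla Y X p = mlieBracket 𝓘(ℝ, E) X Y p :=
  isLeviCivita_leviCivita.torsion_free X Y p (hX.mdifferentiableAt p) (hY.mdifferentiableAt p)

/-- On a totally geodesic submanifold of a Kähler manifold, `T` is parallel. -/
theorem IsTotallyGeodesic.nabla_tangentialEnd (hgeod : IsTotallyGeodesic E E' f)
    (hφ : IsKahler φ) (hf : IsRiemannianSubmanifold E E' f)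
    {X Y : Π x : M, TangentSpace 𝓘(ℝ, E) x} (hX : IsSmoothField X) (hY : IsSmoothField Y) (p : M) :
    nabla X (fun q ↦ tangentialEnd φ f q (Y q)) p = tangentialEnd φ f p (nabla X Y p) := by
  have hTY := hφ.isSmoothField_tangentialEnd hf.smooth hY
  refine ext_inner_right ℝ fun w ↦ ?_
  obtain ⟨Z, hZ, rfl⟩ := exists_isSmoothField_apply_eq p w
  have hgauss : ∀ {W : Π x : M, TangentSpace 𝓘(ℝ, E) x}, IsSmoothField W →
      nablaAlong f (fun q ↦ mfderiv 𝓘(ℝ, E) 𝓘(ℝ, E') f q (W q)) p (X p) =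
        mfderiv 𝓘(ℝ, E) 𝓘(ℝ, E') f p (nabla X W p) :=
    fun hW ↦ sub_eq_zero.1 (hgeod X _ hX hW p)
  have hYd : MDiffAlong E E' f (fun q ↦ mfderiv 𝓘(ℝ, E) 𝓘(ℝ, E') f q (Y q)) p :=
    (contMDiff_mfderiv_apply hf.smooth hY p).mdifferentiableAt (by simp)
  have hZd : MDiffAlong E E' f (fun q ↦ mfderiv 𝓘(ℝ, E) 𝓘(ℝ, E') f q (Z q)) p :=
    (contMDiff_mfderiv_apply hf.smooth hZ p).mdifferentiableAt (by simp)
  have hφYd : MDiffAlong E E' f (fun q ↦ φ (f q) (mfderiv 𝓘(ℝ, E) 𝓘(ℝ, E') f q (Y q))) p :=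
    (hφ.contMDiff_apply_mfderiv hf.smooth hY p).mdifferentiableAt (by simp)
  -- The derivative of `⟪TY, Z⟫ = ⟪φ df Y, df Z⟫` is computed on `M` in `h1` and along `f` in `h2`;
  -- the terms with `∇_X Z` cancel.
  have h1 := isLeviCivita_leviCivita.metric _ Z p (hTY.mdifferentiableAt p)
    (hZ.mdifferentiableAt p) (X p)
  have h2 := mvfderiv_inner_along hφYd hZd (X p)
  rw [hφ.nablaAlong_apply hYd, hgauss hY, hgauss hZ] at h2
  simp only [inner_tangentialEnd] at h1
  rw [h2] at h1
  rw [inner_tangentialEnd]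
  exact (add_right_cancel h1).symm

theorem IsTotallyGeodesic.tangentialEnd_mlieBracket (hgeod : IsTotallyGeodesic E E' f)
    (hφ : IsKahler φ) (hf : IsRiemannianSubmanifold E E' f)
    {X Y : Π x : M, TangentSpace 𝓘(ℝ, E) x} (hX : IsSmoothField X) (hY : IsSmoothField Y) (p : M) :
    tangentialEnd φ f p (mlieBracket 𝓘(ℝ, E) X Y p) =
      nabla X (fun q ↦ tangentialEnd φ f q (Y q)) p
        - nabla Y (fun q ↦ tangentialEnd φ f q (X q)) p := by
  rw [hgeod.nabla_tangentialEnd hφ hf hX hY, hgeod.nabla_tangentialEnd hφ hf hY hX, ← map_sub,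
    nabla_sub_nabla hX hY]

end TotallyGeodesic

end SlantGeometry
-- Integrability of the component distributions.
theorem corollary3p2
    -- the ambient manifold `N`, a Riemannian manifold without boundary
    {E' : Type*} [NormedAddCommGroup E'] [NormedSpace ℝ E'] [FiniteDimensional ℝ E']
    {N : Type*} [TopologicalSpace N] [T2Space N] [ChartedSpace E' N] [IsManifold 𝓘(ℝ, E') ∞ N]
    [RiemannianBundle (fun x : N ↦ TangentSpace 𝓘(ℝ, E') x)]
    [IsContMDiffRiemannianBundle 𝓘(ℝ, E') ∞ E' (fun x : N ↦ TangentSpace 𝓘(ℝ, E') x)]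
    -- the Riemannian manifold `M`, with values in `N` through the immersion `f` below
    {E : Type*} [NormedAddCommGroup E] [NormedSpace ℝ E] [FiniteDimensional ℝ E]
    {M : Type*} [TopologicalSpace M] [T2Space M] [ChartedSpace E M] [IsManifold 𝓘(ℝ, E) ∞ M]
    [RiemannianBundle (fun x : M ↦ TangentSpace 𝓘(ℝ, E) x)]
    [IsContMDiffRiemannianBundle 𝓘(ℝ, E) ∞ E (fun x : M ↦ TangentSpace 𝓘(ℝ, E) x)]
    (φ : Π x : N, TangentSpace 𝓘(ℝ, E') x →L[ℝ] TangentSpace 𝓘(ℝ, E') x) (hφ : IsKahler φ)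
    (f : M → N) (hf : IsRiemannianSubmanifold E E' f)
    (k : ℕ) (D : Fin (k + 1) → Π x : M, Submodule ℝ (TangentSpace 𝓘(ℝ, E) x))
    (θ : Fin (k + 1) → M → ℝ) (hD : IsPointwiseKSlant φ f k D θ)
    (hgeod : IsTotallyGeodesic E E' f) :
    IsIntegrable (D 0) ∧
    ∀ i : Fin (k + 1), (∀ j, j ≠ i → ∀ p, θ j p ≠ Real.pi / 2) →
      (IsIntegrable (D i) ↔
        ∀ X Y : Π x : M, TangentSpace 𝓘(ℝ, E) x, IsSectionOf (D i) X → IsSectionOf (D i) Y →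
          IsSectionOf (D i) (fun p ↦
            nabla X (fun q ↦ tangentialEnd φ f q (Y q)) p
              - nabla Y (fun q ↦ tangentialEnd φ f q (X q)) p)) := by
  have hT : ∀ i p, ∀ u ∈ D i p, tangentialEnd φ f p u ∈ D i p :=
    fun i _ _ hu ↦ hD.tangentialEnd_mem hf i hu
  refine ⟨fun X Y hX hY ↦ ⟨hX.1.mlieBracket hY.1, fun p ↦ ?_⟩, fun i hi ↦ ⟨fun hint X Y hX hY ↦ ?_,
    fun h X Y hX hY ↦ ⟨hX.1.mlieBracket hY.1, fun p ↦ ?_⟩⟩⟩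
  -- `T²` commutes with `∇_W` and `T² Z = -Z`, so `∇_W Z` is again in the kernel of `T² + I`, for
  -- every direction `W`.
  · have hTT : ∀ {Z : Π x : M, TangentSpace 𝓘(ℝ, E) x}, IsSectionOf (D 0) Z →
        ∀ W : Π x : M, TangentSpace 𝓘(ℝ, E) x, IsSmoothField W →
        tangentialEnd φ f p (tangentialEnd φ f p (nabla W Z p)) = -nabla W Z p := by
      intro Z hZ W hW
      have hTZ := hφ.isSmoothField_tangentialEnd hf.smooth hZ.1
      rw [← hgeod.nabla_tangentialEnd hφ hf hW hZ.1, ← hgeod.nabla_tangentialEnd hφ hf hW hTZ]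
      have hsq : (fun q ↦ tangentialEnd φ f q (tangentialEnd φ f q (Z q))) = (-1 : ℝ) • Z := by
        funext q
        rw [hD.invariant.tangentialEnd_tangentialEnd hφ.toIsAlmostHermitian hf (hZ.2 q)]
        simp
      have hneg := leviCivita.isCovariantDerivativeOnUniv.smul_const (-1 : ℝ)
        (hZ.1.mdifferentiableAt p)
      rw [hsq, nabla, hneg, nabla]
      simp
    have hbr : tangentialEnd φ f p (tangentialEnd φ f p (mlieBracket 𝓘(ℝ, E) X Y p)) =
        -mlieBracket 𝓘(ℝ, E) X Y p := by
      rw [← nabla_sub_nabla hX.1 hY.1, map_sub, map_sub, hTT hY X hX.1, hTT hX Y hY.1]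
      abel
    let A : TangentSpace 𝓘(ℝ, E) p →ₗ[ℝ] TangentSpace 𝓘(ℝ, E) p :=
      (tangentialEnd φ f p).toLinearMap ∘ₗ (tangentialEnd φ f p).toLinearMap + LinearMap.id
    have hA : ∀ u, A u = tangentialEnd φ f p (tangentialEnd φ f p u) + u := fun _ ↦ rfl
    refine mem_of_apply_mem_of_isInternal (hD.direct_sum p) (A := A) (fun j u hu ↦ ?_)
      (fun j hj u hu hAu ↦ ?_) ?_
    · rw [hA]
      exact Submodule.add_mem _ (hT j p _ (hT j p u hu)) hu
    · exact hD.eq_zero_of_tangentialEnd_sq hφ.toIsAlmostHermitian hf hj hu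
        (eq_neg_of_add_eq_zero_left hAu)
    · rw [hA, hbr, neg_add_cancel]
      exact Submodule.zero_mem _
  · have hbr : (fun p ↦ nabla X (fun q ↦ tangentialEnd φ f q (Y q)) p
        - nabla Y (fun q ↦ tangentialEnd φ f q (X q)) p) =
        fun p ↦ tangentialEnd φ f p (mlieBracket 𝓘(ℝ, E) X Y p) :=
      funext fun p ↦ (hgeod.tangentialEnd_mlieBracket hφ hf hX.1 hY.1 p).symm
    rw [hbr]
    exact ⟨hφ.isSmoothField_tangentialEnd hf.smooth (hX.1.mlieBracket hY.1),
      fun p ↦ hT i p _ ((hint X Y hX hY).2 p)⟩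
  -- By hypothesis `T[X, Y]` lies in `D i`, and `T` is injective on every other summand.
  · refine mem_of_apply_mem_of_isInternal (hD.direct_sum p)
      (A := (tangentialEnd φ f p).toLinearMap) (fun j u hu ↦ hT j p u hu)
      (fun j hj u hu hu0 ↦ hD.eq_zero_of_tangentialEnd_eq_zero hφ.toIsAlmostHermitian hf
        (hi j hj p) hu hu0) ?_
    have hbr := hgeod.tangentialEnd_mlieBracket hφ hf hX.1 hY.1 p
    exact hbr ▸ (h X Y hX hY).2 p
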